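/- Let $n\ge 3$. Let $\ell_1\le\dots\le\ell_{n-1}$ and $\ell_n^-<\ell_n^+$ be positive real numbers, and put $\ell^\pm=(\ell_1,\dots,\ell_{n-1},\ell_n^\pm)$. The planar linkage $A$ with $n$ cyclically connected bars, of which the first $n-1$ have the fixed lengths $\ell_1,\dots,\ell_{n-1}$ and the last one is telescopic with length varying in $[\ell_n^-,\ell_n^+]$, has the configuration space $$M_A=\{(z_1,\dots,z_n)\in\mathbf C^n:\ |z_{i+1}-z_i|=\ell_i\ (1\le i<n),\ \ \ell_n^-\le|z_1-z_n|\le\ell_n^+\}/E(2),$$ where $E(2)$ is the group of orientation preserving isometries $z\mapsto uz+c$ ($|u|=1$) of the plane. The linkage $A$ is called generic if $\sum_{i=1}^n\epsilon_i\ell_i^-\neq0$ and $\sum_{i=1}^n\epsilon_i\ell_i^+\neq0$ for all $\epsilon_1,\dots,\epsilon_n\in\{1,-1\}$; in this case $M_A$ is a smooth $(n-2)$-dimensional manifold with boundary, with the quotient smooth structure (a function on $M_A$ is smooth if and only if its pull-back to the configurations in $\mathbf C^n$ is smooth). Let $A'$ be the linkage with the first bar removed, that is, with the $n-2$ fixed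 lengths $\ell_2\le\dots\le\ell_{n-1}$ and the same telescopic bar with length in $[\ell_n^-,\ell_n^+]$. Suppose that $A$ and $A'$ are generic and that $\ell_1$ is so small that, for $\ell_n=\ell_n^-$ and for $\ell_n=\ell_n^+$ and for all $\epsilon_2,\dots,\epsilon_n\in\{1,-1\}$, $$\sum_{i=2}^n\epsilon_i\ell_i>0\quad\text{implies}\quad\sum_{i=2}^n\epsilon_i\ell_i>\ell_1 .$$ Then $M_A$ is diffeomorphic to $M_{A'}\times S^1$. -/

import Mathlib

open scoped Manifold ContDiff

noncomputable section

namespace TelescopicLinkage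

/-- Metric data of a planar linkage with `n = d + 2` cyclically connected bars: `n - 1 = d + 1` bars
of fixed positive lengths `ℓ₁ = leg 0, …, ℓₙ₋₁ = leg d`, and a last, telescopic bar whose length
varies in the interval `[lo, hi]`, where `0 < lo < hi`. The index `d = n - 2` is the dimension of
the configuration space. -/
structure MetricData (d : ℕ) where
  leg : Fin (d + 1) → ℝ
  lo : ℝ
  hi : ℝ
  leg_pos : ∀ j, 0 < leg j
  lo_pos : 0 < lo
  lo_lt_hi : lo < hi

/-- The map `F : ℂⁿ → ℝⁿ`, `n = m + 1`, sending the vertices `z` of a closed polygon to its side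
lengths `|z (i + 1) - z i|`; the addition in `Fin (m + 1)` is cyclic. -/
def sideLengths {m : ℕ} (z : Fin (m + 1) → ℂ) : Fin (m + 1) → ℝ :=
  fun i => ‖z (i + 1) - z i‖

/-- A choice of signs. -/
def IsSign {m : ℕ} (ε : Fin m → ℝ) : Prop := ∀ j, ε j = 1 ∨ ε j = -1

namespace MetricData

/-- The length vector `ℓ⁻ = (ℓ₁, …, ℓₙ₋₁, ℓₙ⁻)`. -/
def lower {d : ℕ} (A : MetricData d) : Fin (d + 2) → ℝ := Fin.snoc A.leg A.lo

/-- The length vector `ℓ⁺ = (ℓ₁, …, ℓₙ₋₁, ℓₙ⁺)`. -/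
def upper {d : ℕ} (A : MetricData d) : Fin (d + 2) → ℝ := Fin.snoc A.leg A.hi

/-- The metric data is generic: no signed sum of the coordinates of `ℓ⁻` or of `ℓ⁺` vanishes. -/
def Generic {d : ℕ} (A : MetricData d) : Prop :=
  ∀ ε : Fin (d + 2) → ℝ, IsSign ε → ∑ j, ε j * A.lower j ≠ 0 ∧ ∑ j, ε j * A.upper j ≠ 0

/-- The configurations `F⁻¹(A) ⊆ ℂⁿ`, where the metric data is read as the segment of length
vectors `ℓ` with `ℓ⁻ⱼ ≤ ℓⱼ ≤ ℓ⁺ⱼ` for all `j`. -/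
def configs {d : ℕ} (A : MetricData d) : Set (Fin (d + 2) → ℂ) :=
  sideLengths ⁻¹' Set.Icc A.lower A.upper

/-- Two configurations are equivalent if an orientation preserving isometry `z ↦ u z + c` of the
plane, `|u| = 1`, carries one to the other. -/
def orbitSetoid {d : ℕ} (A : MetricData d) : Setoid A.configs where
  r z w := ∃ (u : Circle) (c : ℂ), ∀ i, (w : Fin (d + 2) → ℂ) i = (u : ℂ) * z.1 i + c
  iseqv :=
    { refl := fun z => ⟨1, 0, fun i => by simp⟩
      symm := by
        rintro z w ⟨u, c, h⟩
        refine ⟨u⁻¹, -((u⁻¹ : Circle) : ℂ) * c, fun i => ?_⟩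
        have hu : (u : ℂ) ≠ 0 := u.coe_ne_zero
        rw [h i, Circle.coe_inv]
        field_simp
        ring
      trans := by
        rintro x y z ⟨u, c, h⟩ ⟨v, e, h'⟩
        refine ⟨v * u, (v : ℂ) * c + e, fun i => ?_⟩
        rw [h' i, h i, Circle.coe_mul]
        ring }

/-- The configuration space `M_A = F⁻¹(A) / E(2)`. -/
def ModuliSpace {d : ℕ} (A : MetricData d) : Type := Quotient A.orbitSetoid

/-- The quotient topology. -/
instance {d : ℕ} (A : MetricData d) : TopologicalSpace A.ModuliSpace :=
  inferInstanceAs (TopologicalSpace (Quotient A.orbitSetoid))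

/-- The projection `F⁻¹(A) → M_A`. -/
def proj {d : ℕ} (A : MetricData d) (z : A.configs) : A.ModuliSpace :=
  Quotient.mk A.orbitSetoid z

/-- A real function on `M_A` is smooth for the quotient structure if its pull-back to
`F⁻¹(A) ⊆ ℂⁿ` is `C^∞` (over `ℝ`). -/
def SmoothOnQuotient {d : ℕ} (A : MetricData d) (f : A.ModuliSpace → ℝ) : Prop :=
  ∃ g : (Fin (d + 2) → ℂ) → ℝ, ContDiffOn ℝ ∞ g A.configs ∧
    ∀ z : A.configs, g z = f (A.proj z)

end MetricData

/-- The local model of `d`-dimensional manifolds with boundary: the closed Euclidean half-space,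
which for `d = 0` is a point. -/
def BoundaryModelSpace : ℕ → Type
  | 0 => EuclideanSpace ℝ (Fin 0)
  | d + 1 => EuclideanHalfSpace (d + 1)

instance : (d : ℕ) → TopologicalSpace (BoundaryModelSpace d)
  | 0 => inferInstanceAs (TopologicalSpace (EuclideanSpace ℝ (Fin 0)))
  | d + 1 => inferInstanceAs (TopologicalSpace (EuclideanHalfSpace (d + 1)))

/-- The model with corners `𝓡∂ d`, extended to `d = 0` by `𝓡 0`. -/
def boundaryModel :
    (d : ℕ) → ModelWithCorners ℝ (EuclideanSpace ℝ (Fin d)) (BoundaryModelSpace d)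
  | 0 => 𝓡 0
  | d + 1 => 𝓡∂ (d + 1)

/-- The smooth structure of `M_A`: `M_A` is a smooth manifold with boundary, of dimension
`n - 2 = d`, whose smooth functions are exactly those with a smooth pull-back to `F⁻¹(A)`.
The last condition determines the structure: a continuous map between smooth manifolds is smooth
as soon as composition with it preserves smooth functions, so that for two such structures the
identity is a diffeomorphism. -/
structure SmoothStructure {d : ℕ} (A : MetricData d) where
  charted : ChartedSpace (BoundaryModelSpace d) A.ModuliSpace
  isManifold : IsManifold (boundaryModel d) ∞ A.ModuliSpace
  smooth_iff : ∀ f : A.ModuliSpace → ℝ,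
    ContMDiff (boundaryModel d) 𝓘(ℝ, ℝ) ∞ f ↔ A.SmoothOnQuotient f

/-- `M_A` with the smooth structure `S`, as a type; it carries the charts of `S`. -/
def SmoothStructure.Carrier {d : ℕ} {A : MetricData d} (_S : SmoothStructure A) : Type :=
  A.ModuliSpace

instance {d : ℕ} {A : MetricData d} (S : SmoothStructure A) : TopologicalSpace S.Carrier :=
  inferInstanceAs (TopologicalSpace A.ModuliSpace)

instance {d : ℕ} {A : MetricData d} (S : SmoothStructure A) :
    ChartedSpace (BoundaryModelSpace d) S.Carrier :=
  S.charted

/-- The linkage with the first leg removed: fixed legs `ℓ₂, …, ℓₙ₋₁`, same telescopic leg. -/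
def MetricData.dropFirst {d : ℕ} (A : MetricData (d + 1)) : MetricData d where
  leg j := A.leg j.succ
  lo := A.lo
  hi := A.hi
  leg_pos j := A.leg_pos j.succ
  lo_pos := A.lo_pos
  lo_lt_hi := A.lo_lt_hi

end TelescopicLinkage

end

/-! Normalise a configuration so that its last fixed bar has direction `1`. The directions of the
other fixed bars then range over a torus, and the only condition left is that the end of the fixed
chain lies at a distance in `[lo, hi]` from its start. So the configuration space is a closed domain
in a torus (`isEmbedding_shape`). At a critical point where this distance is not zero, the chain is
straight (`exists_signs_of_critical`). Hence genericity makes both bounding levels regular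
(`Generic.fderiv_ne_zero`), and the domain inherits a smooth structure from the torus
(`exists_toral_chartedSpace`, `Generic.exists_smoothStructure`).

Now give the first bar a variable length `t` between `0` and `ℓ₁`. At `t = ℓ₁` the domain is that of
`A`. At `t = 0` the first direction is irrelevant, and the domain is a circle times that of `A'`. A
critical point on a bounding level would produce a signed sum of the lengths of `A'` of absolute
value `t ≤ ℓ₁`. Smallness of `ℓ₁` and genericity of `A'` exclude this
(`exists_fderiv_shrunk_ne_zero`). The levels therefore stay regular, and the flow of a vector field
tangent to them in space-time carries one domain to the other (`exists_isotopy`). Everything is done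
on the universal covering of the torus and then pushed down (`nonempty_diffeomorph_of_torus_equiv`).

The vector field is periodic, hence globally Lipschitz. The smooth dependence of its flow on the
initial point (`exists_flow_equiv`) comes from solving the integral equation in a Banach space of
curves, by inverting a smooth contractive perturbation of the identity. -/

noncomputable section

namespace TelescopicLinkage

open Set Filter Topology

/-! ### Smoothness of postcomposition on spaces of continuous maps -/

section Postcomposition

variable {K V : Type*} [TopologicalSpace K] [CompactSpace K]
  [NormedAddCommGroup V] [NormedSpace ℝ V]

/-- Pointwise application of a continuous family of operators to a continuous curve. -/
def pointwiseApply {W : Type*} [NormedAddCommGroup W] [NormedSpace ℝ W] :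
    C(K, V →L[ℝ] W) →L[ℝ] C(K, V) →L[ℝ] C(K, W) :=
  LinearMap.mkContinuous₂
    (LinearMap.mk₂ ℝ (fun (T : C(K, V →L[ℝ] W)) (η : C(K, V)) =>
      (⟨fun k => T k (η k), by fun_prop⟩ : C(K, W)))
      (fun _ _ _ => by ext; simp) (fun _ _ _ => by ext; simp)
      (fun _ _ _ => by ext; simp) (fun _ _ _ => by ext; simp))
    1 (fun T η => by
      rw [one_mul]
      refine (ContinuousMap.norm_le _ (by positivity)).2 fun k => ?_
      exact ((T k).le_opNorm _).trans
        (mul_le_mul (T.norm_coe_le_norm k) (η.norm_coe_le_norm k) (norm_nonneg _)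
          (norm_nonneg (T : C(K, V →L[ℝ] W)))))

@[simp]
theorem pointwiseApply_apply {W : Type*} [NormedAddCommGroup W] [NormedSpace ℝ W]
    (T : C(K, V →L[ℝ] W)) (η : C(K, V)) (k : K) : pointwiseApply T η k = T k (η k) := rfl

/-- The mean value inequality on the segments from `γ k` to `γ k + η k` gives the error bound. It is
uniform in `k` because `γ ↦ f' ∘ γ` is continuous for the sup norm, applied to the curves `γ + t •
η`. -/
theorem hasFDerivAt_postcomp {W : Type*} [NormedAddCommGroup W] [NormedSpace ℝ W]
    (f : C(V, W)) (f' : C(V, V →L[ℝ] W)) (hf : ∀ x, HasFDerivAt f (f' x) x) (γ : C(K, V)) :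
    HasFDerivAt (fun γ : C(K, V) => f.comp γ) (pointwiseApply (f'.comp γ)) γ := by
  rw [hasFDerivAt_iff_isLittleO_nhds_zero, Asymptotics.isLittleO_iff]
  intro c hc
  have hcont : Continuous fun γ : C(K, V) => f'.comp γ := f'.continuous_postcomp
  obtain ⟨δ, hδ, hball⟩ := (Metric.continuous_iff (α := C(K, V)) (β := C(K, V →L[ℝ] W))).1 hcont γ c hc
  filter_upwards [Metric.ball_mem_nhds 0 hδ] with η hη
  rw [mem_ball_zero_iff] at hη
  refine (ContinuousMap.norm_le _ (by positivity)).2 fun k => ?_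
  have hbound : ∀ x ∈ segment ℝ (γ k) (γ k + η k), ‖f' x - f' (γ k)‖ ≤ c := by
    intro x hx
    rw [segment_eq_image'] at hx
    obtain ⟨t, ht, rfl⟩ := hx
    have h1 : dist (γ + t • η) γ < δ := by
      rw [dist_eq_norm, add_sub_cancel_left, norm_smul, Real.norm_of_nonneg ht.1]
      nlinarith [norm_nonneg η, ht.2]
    have h2 := (ContinuousMap.dist_apply_le_dist k).trans (hball _ h1).le
    rw [dist_eq_norm] at h2
    simpa using h2
  have := (convex_segment (𝕜 := ℝ) (γ k) (γ k + η k)).norm_image_sub_le_of_norm_hasFDerivWithin_le'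
    (f := f) (f' := fun x => f' x) (φ := f' (γ k)) (fun x _ => (hf x).hasFDerivWithinAt) hbound
    (left_mem_segment ℝ _ _) (right_mem_segment ℝ _ _)
  refine le_trans (le_of_eq ?_) (this.trans ?_)
  · simp
  · rw [add_sub_cancel_left]
    exact mul_le_mul_of_nonneg_left (η.norm_coe_le_norm k) hc.le

end Postcomposition

universe u

/-- The derivative is postcomposition with `f'` followed by the bounded linear `pointwiseApply`, so
the order goes up by induction. The induction passes from `W` to `V →L[ℝ] W`, which is why `V` and
`W` share a universe. -/
theorem contDiff_nat_postcomp {K : Type*} [TopologicalSpace K] [CompactSpace K] {V : Type u}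
    [NormedAddCommGroup V] [NormedSpace ℝ V] (n : ℕ) :
    ∀ {W : Type u} [NormedAddCommGroup W] [NormedSpace ℝ W] (f : C(V, W)),
      ContDiff ℝ n f → ContDiff ℝ n (fun γ : C(K, V) => f.comp γ) := by
  induction n with
  | zero =>
    intro W _ _ f _
    exact contDiff_zero.2 f.continuous_postcomp
  | succ n ih =>
    intro W _ _ f hf
    rw [Nat.cast_add, Nat.cast_one] at hf ⊢
    obtain ⟨f', hf', hder⟩ := contDiff_succ_iff_hasFDerivAt.1 hf
    exact contDiff_succ_iff_hasFDerivAt.2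
      ⟨_, (pointwiseApply (K := K) (V := V) (W := W)).contDiff.comp (ih ⟨f', hf'.continuous⟩ hf'),
        hasFDerivAt_postcomp f ⟨f', hf'.continuous⟩ hder⟩

theorem contDiff_postcomp {K : Type*} [TopologicalSpace K] [CompactSpace K] {V W : Type u}
    [NormedAddCommGroup V] [NormedSpace ℝ V] [NormedAddCommGroup W] [NormedSpace ℝ W] (f : C(V, W))
    (hf : ContDiff ℝ ∞ f) : ContDiff ℝ ∞ (fun γ : C(K, V) => f.comp γ) :=
  contDiff_infty.2 fun n => contDiff_nat_postcomp n f (hf.of_le (by exact_mod_cast le_top))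

/-- A smooth perturbation of the identity by a contraction is a diffeomorphism. -/
theorem exists_smooth_inverse_id_sub {X : Type*} [NormedAddCommGroup X] [NormedSpace ℝ X]
    [CompleteSpace X] {g : X → X} (hg : ContDiff ℝ ∞ g) {c : NNReal} (hc : c < 1)
    (hL : LipschitzWith c g) :
    ∃ Θ : X ≃ X, (∀ x, Θ x = x - g x) ∧ ContDiff ℝ ∞ Θ.symm := by
  -- The preimages of `y` under `x ↦ x - g x` are the fixed points of this contraction.
  have hcon (y : X) : ContractingWith c (fun x => y + g x) :=
    ⟨hc, by simpa using (LipschitzWith.const y).add hL⟩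
  have hbij : Function.Bijective (fun x => x - g x) := by
    constructor
    · intro x x' h
      refine (hcon (x - g x)).fixedPoint_unique' (x := x) (y := x') ?_ ?_
      · simp [Function.IsFixedPt]
      · simp only at h
        simp [Function.IsFixedPt, h]
    · intro y
      refine ⟨(hcon y).fixedPoint, ?_⟩
      have : y + g ((hcon y).fixedPoint) = (hcon y).fixedPoint := (hcon y).fixedPoint_isFixedPt
      exact sub_eq_of_eq_add this.symm
  let Θ : X ≃ X := Equiv.ofBijective _ hbij
  have hΘ (x : X) : Θ x = x - g x := rfl
  refine ⟨Θ, hΘ, contDiff_iff_contDiffAt.2 fun y => ?_⟩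
  obtain ⟨a, rfl⟩ := Θ.surjective y
  have hsm : ContDiff ℝ ∞ (Θ : X → X) := contDiff_id.sub hg
  have hnorm : ‖fderiv ℝ g a‖ < 1 :=
    lt_of_le_of_lt (norm_fderiv_le_of_lipschitz ℝ hL) (by exact_mod_cast hc)
  -- The differential is invertible by the Neumann series. The smooth local inverse then coincides
  -- with the global one near `Θ a`.
  let e : X ≃L[ℝ] X := ContinuousLinearEquiv.unitsEquiv ℝ X (Units.oneSub (fderiv ℝ g a) hnorm)
  have he : HasFDerivAt (Θ : X → X) (e : X →L[ℝ] X) a := by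
    have : (e : X →L[ℝ] X) = ContinuousLinearMap.id ℝ X - fderiv ℝ g a := by
      ext v; rfl
    rw [this]
    exact (hasFDerivAt_id a).sub (hg.differentiable (by simp) a).hasFDerivAt
  have h1 := hsm.contDiffAt.to_localInverse he (by simp)
  have h2 := hsm.contDiffAt.image_mem_toOpenPartialHomeomorph_target he (by simp)
  refine h1.congr_of_eventuallyEq ?_
  filter_upwards [(hsm.contDiffAt.toOpenPartialHomeomorph _ he (by simp)).open_target.mem_nhds h2]
    with y hy
  rw [Equiv.symm_apply_eq]
  exact ((hsm.contDiffAt.toOpenPartialHomeomorph _ he (by simp)).right_inv hy).symm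

/-! ### Flows of smooth Lipschitz vector fields -/

section Flow

variable {V : Type u} [NormedAddCommGroup V] [NormedSpace ℝ V]

/-- The extension of a curve on the unit interval that is constant on both sides. -/
abbrev extendCurve (γ : C(unitInterval, V)) : ℝ → V := IccExtend (zero_le_one' ℝ) γ

/-- Integration of curves from the left end of the unit interval. -/
def primitive : C(unitInterval, V) →L[ℝ] C(unitInterval, V) :=
  LinearMap.mkContinuous
    { toFun := fun γ => ⟨fun t => ∫ s in (0 : ℝ)..t, extendCurve γ s, by
        have h : Continuous (extendCurve γ) := γ.continuous.Icc_extend'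
        exact (intervalIntegral.continuous_primitive
          (fun a b => h.intervalIntegrable a b) 0).comp continuous_subtype_val⟩
      map_add' := fun γ η => by
        ext t
        have h (γ : C(unitInterval, V)) : Continuous (extendCurve γ) := γ.continuous.Icc_extend'
        exact intervalIntegral.integral_add ((h γ).intervalIntegrable _ _)
          ((h η).intervalIntegrable _ _)
      map_smul' := fun c γ => by
        ext t
        exact intervalIntegral.integral_smul c _ }
    1 (fun γ => by
      rw [one_mul]
      refine (ContinuousMap.norm_le _ (norm_nonneg γ)).2 fun t => ?_
      have := intervalIntegral.norm_integral_le_of_norm_le_const (a := 0) (b := t)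
        (f := extendCurve γ) (C := ‖γ‖) (fun s _ => γ.norm_coe_le_norm _)
      refine this.trans ?_
      rw [sub_zero, abs_of_nonneg t.2.1]
      exact mul_le_of_le_one_right (norm_nonneg γ) t.2.2)

theorem primitive_apply (γ : C(unitInterval, V)) (t : unitInterval) :
    primitive γ t = ∫ s in (0 : ℝ)..t, extendCurve γ s := rfl

theorem lipschitzWith_primitive : LipschitzWith 1 (primitive : C(unitInterval, V) → _) :=
  (primitive (V := V)).lipschitz.weaken
    (LinearMap.mkContinuous_norm_le _ zero_le_one _)

/-- `Φ` is the time-one map of the vector field `f`. -/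
def IsTimeOneMap (f Φ : V → V) : Prop :=
  ∀ x, ∃ γ : ℝ → V, γ 0 = x ∧ γ 1 = Φ x ∧ ∀ t ∈ Icc (0 : ℝ) 1, HasDerivAt γ (f (γ t)) t

/-- An integral curve from `x` solves `γ - primitive (f ∘ γ) = const x`. Since `primitive` is
1-Lipschitz, the left side is a contractive perturbation of the identity on the space of curves. Its
smooth inverse, between `x ↦ const x` and evaluation at `1`, is the time-one map. -/
theorem exists_smooth_timeOneMap [CompleteSpace V] {f : V → V} (hf : ContDiff ℝ ∞ f) {c : NNReal} (hc : c < 1)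
    (hL : LipschitzWith c f) : ∃ Φ : V → V, ContDiff ℝ ∞ Φ ∧ IsTimeOneMap f Φ := by
  let F : C(V, V) := ⟨f, hf.continuous⟩
  have hg : ContDiff ℝ ∞ (fun γ : C(unitInterval, V) => primitive (F.comp γ)) :=
    (primitive (V := V)).contDiff.comp (contDiff_postcomp F hf)
  have hLg : LipschitzWith c (fun γ : C(unitInterval, V) => primitive (F.comp γ)) := by
    have h1 : LipschitzWith c (fun γ : C(unitInterval, V) => F.comp γ) := by
      refine LipschitzWith.of_dist_le_mul fun γ η => ?_
      refine (ContinuousMap.dist_le (by positivity)).2 fun t => ?_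
      exact (hL.dist_le_mul _ _).trans
        (mul_le_mul_of_nonneg_left (ContinuousMap.dist_apply_le_dist t) c.2)
    have h2 := lipschitzWith_primitive.comp h1
    rwa [one_mul] at h2
  obtain ⟨Θ, hΘ, hsm⟩ := exists_smooth_inverse_id_sub hg hc hLg
  refine ⟨fun x => Θ.symm (ContinuousMap.const _ x) 1, ?_, fun x => ?_⟩
  · exact (ContinuousMap.evalCLM ℝ (1 : unitInterval)).contDiff.comp
      (hsm.comp (ContinuousLinearMap.const ℝ unitInterval).contDiff)
  · set γ := Θ.symm (ContinuousMap.const _ x) with hγ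
    have hcont : Continuous fun s => f (extendCurve γ s) :=
      hf.continuous.comp γ.continuous.Icc_extend'
    have heq (t : ℝ) (ht : t ∈ Icc (0 : ℝ) 1) :
        x + ∫ s in (0 : ℝ)..t, f (extendCurve γ s) = γ ⟨t, ht⟩ := by
      have h1 : Θ γ = ContinuousMap.const _ x := Θ.apply_symm_apply _
      rw [hΘ] at h1
      have h2 := congrArg (fun η : C(unitInterval, V) => η ⟨t, ht⟩) h1
      simp only [ContinuousMap.sub_apply, ContinuousMap.const_apply, primitive_apply] at h2
      rw [← h2]
      exact sub_add_cancel _ _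
    -- The integral formula defines the curve on all of `ℝ`, so it has two-sided derivatives at the
    -- endpoints as well.
    refine ⟨fun t => x + ∫ s in (0 : ℝ)..t, f (extendCurve γ s), by simp,
      heq 1 ⟨zero_le_one, le_rfl⟩, fun t ht => ?_⟩
    have h3 := (intervalIntegral.integral_hasDerivAt_right (hcont.intervalIntegrable 0 t)
      (hcont.stronglyMeasurableAtFilter _ _) hcont.continuousAt).const_add x
    convert h3 using 2
    refine (heq t ht).trans ?_
    rw [extendCurve, IccExtend_of_mem _ _ ht]

theorem IsTimeOneMap.unique_curve {f Φ : V → V} (h : IsTimeOneMap f Φ) {c : NNReal}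
    (hL : LipschitzWith c f) {γ : ℝ → V}
    (hγ : ∀ t ∈ Icc (0 : ℝ) 1, HasDerivAt γ (f (γ t)) t) : Φ (γ 0) = γ 1 := by
  obtain ⟨η, h0, h1, hη⟩ := h (γ 0)
  rw [← h1]
  refine ODE_solution_unique (v := fun _ => f) (K := c) (a := 0) (b := 1) (fun _ => hL)
    (fun t ht => (hη t ht).continuousAt.continuousWithinAt)
    (fun t ht => (hη t ⟨ht.1, ht.2.le⟩).hasDerivWithinAt)
    (fun t ht => (hγ t ht).continuousAt.continuousWithinAt)
    (fun t ht => (hγ t ⟨ht.1, ht.2.le⟩).hasDerivWithinAt) h0 ⟨zero_le_one, le_rfl⟩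

/-- A trajectory of `f` run backwards is a trajectory of `-f`; uniqueness does the rest. -/
theorem IsTimeOneMap.leftInverse {f Φ Ψ : V → V} (h : IsTimeOneMap f Φ)
    (h' : IsTimeOneMap (-f) Ψ) {c : NNReal} (hL : LipschitzWith c f) :
    Function.LeftInverse Ψ Φ := by
  intro x
  obtain ⟨γ, h0, h1, hγ⟩ := h x
  have := h'.unique_curve hL.neg (γ := fun t => γ (1 - t)) (fun t ht => by
    have h2 := (hγ (1 - t) ⟨by linarith [ht.2], by linarith [ht.1]⟩).scomp t
      ((hasDerivAt_id t).const_sub 1)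
    simpa [Function.comp_def] using h2)
  simpa [h0, h1] using this

theorem IsTimeOneMap.add_period {f Φ : V → V} (h : IsTimeOneMap f Φ) {c : NNReal}
    (hL : LipschitzWith c f) {v : V} (hv : ∀ x, f (x + v) = f x) (x : V) : Φ (x + v) = Φ x + v := by
  obtain ⟨γ, h0, h1, hγ⟩ := h x
  have := h.unique_curve hL (γ := fun t => γ t + v) (fun t ht => by
    rw [hv]; exact (hγ t ht).add_const v)
  simpa [h0, h1] using this

theorem IsTimeOneMap.apply_linear {f Φ : V → V} (h : IsTimeOneMap f Φ) {L : V →L[ℝ] ℝ} {a : ℝ}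
    (hLf : ∀ x, L (f x) = a) (x : V) : L (Φ x) = L x + a := by
  obtain ⟨γ, h0, h1, hγ⟩ := h x
  have h2 (t : ℝ) (ht : t ∈ Icc (0 : ℝ) 1) : HasDerivAt (fun t => L (γ t) - a * t) 0 t := by
    have := (L.hasFDerivAt.comp_hasDerivAt t (hγ t ht)).sub ((hasDerivAt_id t).const_mul a)
    rw [hLf, mul_one, sub_self] at this
    exact this
  have h3 := constant_of_has_deriv_right_zero (a := 0) (b := 1)
    (fun t ht => (h2 t ht).continuousAt.continuousWithinAt)
    (fun t ht => (h2 t ⟨ht.1, ht.2.le⟩).hasDerivWithinAt) 1 ⟨zero_le_one, le_rfl⟩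
  simp only [h0, h1] at h3
  linarith

/-- Along a trajectory `Y` solves the linear equation `Y' = c Y`, so it is its initial value times
the exponential of an integral and cannot change sign. -/
theorem IsTimeOneMap.nonneg_iff {f Φ : V → V} (h : IsTimeOneMap f Φ) {Y c : V → ℝ}
    (hY : ContDiff ℝ ∞ Y) (hc : Continuous c) (hYf : ∀ x, fderiv ℝ Y x (f x) = c x * Y x) (x : V) :
    0 ≤ Y (Φ x) ↔ 0 ≤ Y x := by
  obtain ⟨γ, h0, h1, hγ⟩ := h x
  have hγc : ContinuousOn (fun t => c (γ t)) (Icc (0 : ℝ) 1) := fun t ht =>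
    (hc.continuousAt.comp (hγ t ht).continuousAt).continuousWithinAt
  let b : ℝ → ℝ := IccExtend (zero_le_one' ℝ) ((Icc (0 : ℝ) 1).domRestrict fun t => c (γ t))
  have hb : Continuous b := (continuousOn_iff_continuous_domRestrict.1 hγc).Icc_extend'
  have hbt (t : ℝ) (ht : t ∈ Icc (0 : ℝ) 1) : b t = c (γ t) := by
    simp only [b]
    rw [IccExtend_of_mem _ _ ht]; rfl
  let B : ℝ → ℝ := fun t => ∫ s in (0 : ℝ)..t, b s
  have hB (t : ℝ) : HasDerivAt B (b t) t :=
    intervalIntegral.integral_hasDerivAt_right (hb.intervalIntegrable 0 t)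
      (hb.stronglyMeasurableAtFilter _ _) hb.continuousAt
  have h2 (t : ℝ) (ht : t ∈ Icc (0 : ℝ) 1) :
      HasDerivAt (fun t => Y (γ t) * Real.exp (-B t)) 0 t := by
    have h3 := ((hY.differentiable (by simp) (γ t)).hasFDerivAt.comp_hasDerivAt t (hγ t ht)).mul
      (hB t).neg.exp
    refine h3.congr_deriv ?_
    rw [hYf, hbt t ht]
    simp only [Function.comp_apply]
    ring
  have h3 := constant_of_has_deriv_right_zero (a := 0) (b := 1)
    (fun t ht => (h2 t ht).continuousAt.continuousWithinAt)
    (fun t ht => (h2 t ⟨ht.1, ht.2.le⟩).hasDerivWithinAt) 1 ⟨zero_le_one, le_rfl⟩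
  have hB0 : B 0 = 0 := by simp [B]
  simp only [h0, h1, hB0, neg_zero, Real.exp_zero, mul_one] at h3
  rw [← h3]
  exact (mul_nonneg_iff_of_pos_right (Real.exp_pos _)).symm

/-- The time-one flow of a smooth Lipschitz vector field `f` is a diffeomorphism; it commutes with
the periods of `f`, translates linear functionals that are constant along `f` and preserves the
sign of functions `Y` whose derivative along `f` is a multiple of `Y`. -/
theorem exists_flow_equiv [CompleteSpace V] {f : V → V} (hf : ContDiff ℝ ∞ f) {c : NNReal} (hL : LipschitzWith c f) :
    ∃ Φ : V ≃ V, ContDiff ℝ ∞ Φ ∧ ContDiff ℝ ∞ Φ.symm ∧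
      (∀ v, (∀ x, f (x + v) = f x) → ∀ x, Φ (x + v) = Φ x + v) ∧
      (∀ (L : V →L[ℝ] ℝ) (a : ℝ), (∀ x, L (f x) = a) → ∀ x, L (Φ x) = L x + a) ∧
      (∀ Y b : V → ℝ, ContDiff ℝ ∞ Y → Continuous b → (∀ x, fderiv ℝ Y x (f x) = b x * Y x) →
        ∀ x, 0 ≤ Y (Φ x) ↔ 0 ≤ Y x) := by
  -- Dividing `f` by `N > c` brings the Lipschitz constant below `1`. The time-one flow of `f` is
  -- the `N`-th iterate of that of `f / N`.
  obtain ⟨N, hN⟩ := exists_nat_gt (c : ℝ)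
  have hN0 : (0 : ℝ) < N := lt_of_le_of_lt c.2 hN
  let k : NNReal := ‖(N : ℝ)⁻¹‖₊ * c
  have hk : k < 1 := by
    rw [← NNReal.coe_lt_coe]
    simp only [k, NNReal.coe_mul, coe_nnnorm, norm_inv, Real.norm_natCast, NNReal.coe_one]
    rw [inv_mul_lt_one₀ hN0]; exact hN
  let f₁ : V → V := fun x => (N : ℝ)⁻¹ • f x
  have hf₁ : ContDiff ℝ ∞ f₁ := hf.const_smul _
  have hL₁ : LipschitzWith k f₁ := (lipschitzWith_smul ((N : ℝ)⁻¹)).comp hL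
  obtain ⟨Φ, hΦ, hΦ1⟩ := exists_smooth_timeOneMap hf₁ hk hL₁
  obtain ⟨Ψ, hΨ, hΨ1⟩ := exists_smooth_timeOneMap hf₁.neg hk hL₁.neg
  have hleft : Function.LeftInverse Ψ Φ := hΦ1.leftInverse hΨ1 hL₁
  have hright : Function.RightInverse Ψ Φ := hΨ1.leftInverse
    (f := -f₁) (by rw [neg_neg]; exact hΦ1) hL₁.neg
  have hiter (g : V → V) (hg : ContDiff ℝ ∞ g) (n : ℕ) : ContDiff ℝ ∞ g^[n] := by
    induction n with
    | zero => exact contDiff_id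
    | succ n ih => exact ih.comp hg
  refine ⟨⟨Φ^[N], Ψ^[N], hleft.iterate N, hright.iterate N⟩, hiter Φ hΦ N, hiter Ψ hΨ N, ?_, ?_, ?_⟩
  · intro v hv x
    have h (n : ℕ) : Φ^[n] (x + v) = Φ^[n] x + v := by
      induction n with
      | zero => rfl
      | succ n ih =>
        rw [Function.iterate_succ_apply', ih, Function.iterate_succ_apply']
        exact hΦ1.add_period hL₁ (fun y => by simp only [f₁, hv]) _
    exact h N
  · intro L a hLa x
    have h (n : ℕ) : L (Φ^[n] x) = L x + n * ((N : ℝ)⁻¹ * a) := by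
      induction n with
      | zero => simp
      | succ n ih =>
        rw [Function.iterate_succ_apply', hΦ1.apply_linear (L := L) (a := (N : ℝ)⁻¹ * a)
          (fun y => by simp [f₁, hLa]), ih]
        push_cast; ring
    refine (h N).trans ?_
    rw [mul_inv_cancel_left₀ hN0.ne']
  · intro Y b hY hb hYf x
    have h (n : ℕ) : 0 ≤ Y (Φ^[n] x) ↔ 0 ≤ Y x := by
      induction n with
      | zero => rfl
      | succ n ih =>
        rw [Function.iterate_succ_apply', ← ih]
        exact hΦ1.nonneg_iff hY (hb.const_mul ((N : ℝ)⁻¹)) (fun y => by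
          simp [f₁, hYf, mul_assoc]) _
    exact h N

end Flow

/-! ### Angle coordinates on the torus -/

section Torus

variable {D : ℕ}

/-- The universal covering of the torus. -/
def torusExp (x : EuclideanSpace ℝ (Fin D)) : Fin D → Circle := fun j => Circle.exp (x j)

/-- The branch of the inverse of `torusExp` that is centred at `a`. -/
def angles (a : EuclideanSpace ℝ (Fin D)) (u : Fin D → Circle) : EuclideanSpace ℝ (Fin D) :=
  WithLp.toLp 2 fun j => a j + Complex.arg (u j * (Circle.exp (a j))⁻¹ : Circle)

/-- The open subset of the torus on which `angles a` is continuous. -/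
def branchDomain (a : EuclideanSpace ℝ (Fin D)) : Set (Fin D → Circle) :=
  {u | ∀ j, ((u j * (Circle.exp (a j))⁻¹ : Circle) : ℂ) ∈ Complex.slitPlane}

theorem continuous_torusExp : Continuous (torusExp : EuclideanSpace ℝ (Fin D) → _) :=
  continuous_pi fun j => Circle.exp.continuous.comp (by fun_prop)

@[simp]
theorem torusExp_angles (a : EuclideanSpace ℝ (Fin D)) (u : Fin D → Circle) :
    torusExp (angles a u) = u := by
  funext j
  simp only [torusExp, angles, Circle.exp_add, Circle.exp_arg]
  rw [mul_comm, inv_mul_cancel_right]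

theorem torusExp_surjective :
    Function.Surjective (torusExp : EuclideanSpace ℝ (Fin D) → _) :=
  fun u => ⟨angles 0 u, torusExp_angles 0 u⟩

theorem exp_mul_inv_exp (s t : ℝ) : Circle.exp s * (Circle.exp t)⁻¹ = Circle.exp (s - t) := by
  rw [← Circle.exp_neg, ← Circle.exp_add, sub_eq_add_neg]

theorem angles_torusExp {a x : EuclideanSpace ℝ (Fin D)} (h : ∀ j, |x j - a j| < Real.pi) :
    angles a (torusExp x) = x := by
  ext j
  simp only [angles, torusExp, exp_mul_inv_exp]
  rw [Circle.arg_exp (by linarith [(abs_lt.1 (h j)).1]) (abs_lt.1 (h j)).2.le]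
  ring

theorem torusExp_mem_branchDomain {a x : EuclideanSpace ℝ (Fin D)}
    (h : ∀ j, |x j - a j| < Real.pi) : torusExp x ∈ branchDomain a := by
  intro j
  simp only [torusExp, exp_mul_inv_exp]
  rw [Complex.mem_slitPlane_iff_arg,
    Circle.arg_exp (by linarith [(abs_lt.1 (h j)).1]) (abs_lt.1 (h j)).2.le]
  exact ⟨(abs_lt.1 (h j)).2.ne, Circle.coe_ne_zero _⟩

theorem torusExp_mem_branchDomain_self (a : EuclideanSpace ℝ (Fin D)) :
    torusExp a ∈ branchDomain a :=
  torusExp_mem_branchDomain fun j => by simp [Real.pi_pos]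

theorem abs_angles_sub_lt {a : EuclideanSpace ℝ (Fin D)} {u : Fin D → Circle}
    (h : u ∈ branchDomain a) (j : Fin D) : |angles a u j - a j| < Real.pi := by
  have h1 := Complex.mem_slitPlane_iff_arg.1 (h j)
  simp only [angles, add_sub_cancel_left]
  exact lt_of_le_of_ne (Complex.abs_arg_le_pi _) fun h2 => by
    rcases (abs_eq Real.pi_pos.le).1 h2 with h3 | h3
    · exact h1.1 h3
    · linarith [Complex.neg_pi_lt_arg ((u j * (Circle.exp (a j))⁻¹ : Circle) : ℂ)]

theorem isOpen_branchDomain (a : EuclideanSpace ℝ (Fin D)) : IsOpen (branchDomain a) := by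
  have : branchDomain a = ⋂ j, (fun u : Fin D → Circle =>
      ((u j * (Circle.exp (a j))⁻¹ : Circle) : ℂ)) ⁻¹' Complex.slitPlane := by
    ext u; simp [branchDomain]
  rw [this]
  exact isOpen_iInter_of_finite fun j => Complex.isOpen_slitPlane.preimage (by fun_prop)

theorem continuousOn_angles (a : EuclideanSpace ℝ (Fin D)) :
    ContinuousOn (angles a) (branchDomain a) := by
  refine (PiLp.continuous_toLp 2 _).comp_continuousOn (continuousOn_pi.2 fun j => ?_)
  refine continuousOn_const.add fun u hu => ?_
  refine ((Complex.continuousAt_arg (hu j)).comp (f := fun u : Fin D → Circle =>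
    ((u j * (Circle.exp (a j))⁻¹ : Circle) : ℂ)) ?_).continuousWithinAt
  exact (continuous_subtype_val.comp ((continuous_apply j).mul continuous_const)).continuousAt

theorem contDiffAt_arg {z : ℂ} (h : z ∈ Complex.slitPlane) : ContDiffAt ℝ ∞ Complex.arg z := by
  have h1 : ContDiffAt ℝ ∞ Complex.log z := (Complex.contDiffAt_log h).restrict_scalars ℝ
  exact (Complex.imCLM.contDiff.contDiffAt.comp z h1).congr_of_eventuallyEq
    (Eventually.of_forall fun w => by simp [Complex.log_im])

theorem contDiffAt_angles_torusExp {a x : EuclideanSpace ℝ (Fin D)}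
    (h : torusExp x ∈ branchDomain a) :
    ContDiffAt ℝ ∞ (fun x => angles a (torusExp x)) x := by
  refine (contDiffAt_piLp 2).2 fun j => ?_
  refine contDiffAt_const.add ((contDiffAt_arg (h j)).comp x (f := fun y =>
    ((torusExp y j * (Circle.exp (a j))⁻¹ : Circle) : ℂ)) ?_)
  simp only [torusExp, Circle.coe_mul, Circle.coe_exp]
  have h1 : ContDiff ℝ ∞ fun y : EuclideanSpace ℝ (Fin D) => ((y j : ℝ) : ℂ) :=
    Complex.ofRealCLM.contDiff.comp (by fun_prop)
  exact ((h1.mul contDiff_const).cexp.mul contDiff_const).contDiffAt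

end Torus

/-! ### Domains of the torus as manifolds with boundary -/

section ToralDomain

variable {D : ℕ} {H M : Type*} [TopologicalSpace H] [TopologicalSpace M]
  (I : ModelWithCorners ℝ (EuclideanSpace ℝ (Fin D)) H) (R : M → Fin D → Circle)

/-- The preimage of the image of `R` in the universal covering of the torus. -/
def liftedDomain : Set (EuclideanSpace ℝ (Fin D)) := {x | torusExp x ∈ range R}

/-- A diffeomorphism between open sets that near `x` carries `W` to the range of the model `I`. -/
def IsStraightenedAt (W : Set (EuclideanSpace ℝ (Fin D))) (x : EuclideanSpace ℝ (Fin D))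
    (ψ : OpenPartialHomeomorph (EuclideanSpace ℝ (Fin D)) (EuclideanSpace ℝ (Fin D))) : Prop :=
  x ∈ ψ.source ∧ ContDiffOn ℝ ∞ ψ ψ.source ∧ ContDiffOn ℝ ∞ ψ.symm ψ.target ∧
    ∀ y ∈ ψ.source, y ∈ W ↔ ψ y ∈ range I

/-- The manifold structure of `M` for which `R` is a diffeomorphism onto a domain of the torus. -/
def IsToral [ChartedSpace H M] : Prop :=
  (∀ p a, R p ∈ branchDomain a →
    ContMDiffAt I 𝓘(ℝ, EuclideanSpace ℝ (Fin D)) ∞ (fun p => angles a (R p)) p) ∧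
  ∀ F : EuclideanSpace ℝ (Fin D) → M, (∀ x ∈ liftedDomain R, R (F x) = torusExp x) →
    ContMDiffOn 𝓘(ℝ, EuclideanSpace ℝ (Fin D)) I ∞ F (liftedDomain R)

variable {R}

omit [TopologicalSpace M] in
theorem angles_mem_liftedDomain (a : EuclideanSpace ℝ (Fin D)) (p : M) :
    angles a (R p) ∈ liftedDomain R := ⟨p, (torusExp_angles _ _).symm⟩

omit [TopologicalSpace M] in
theorem apply_invFun_torusExp [Nonempty M] {x : EuclideanSpace ℝ (Fin D)}
    (hx : x ∈ liftedDomain R) : R (Function.invFun R (torusExp x)) = torusExp x :=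
  Function.invFun_eq hx

theorem continuousOn_of_apply_eq (hR : IsEmbedding R) {F : EuclideanSpace ℝ (Fin D) → M}
    (hF : ∀ x ∈ liftedDomain R, R (F x) = torusExp x) : ContinuousOn F (liftedDomain R) :=
  hR.isInducing.continuousOn_iff.2 (continuous_torusExp.continuousOn.congr hF)

/-- The chart of `M` given by a branch of the angles followed by a straightening. -/
def toralChart [Nonempty M] (hR : IsEmbedding R) (a : EuclideanSpace ℝ (Fin D))
    (ψ : OpenPartialHomeomorph (EuclideanSpace ℝ (Fin D)) (EuclideanSpace ℝ (Fin D)))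
    (hψ : ∀ y ∈ ψ.source, y ∈ liftedDomain R ↔ ψ y ∈ range I) : OpenPartialHomeomorph M H where
  toFun p := I.symm (ψ (angles a (R p)))
  invFun q := Function.invFun R (torusExp (ψ.symm (I q)))
  source := {p | R p ∈ branchDomain a ∧ angles a (R p) ∈ ψ.source}
  target := {q | I q ∈ ψ.target ∧ ∀ j, |ψ.symm (I q) j - a j| < Real.pi}
  map_source' p hp := by
    have h1 : ψ (angles a (R p)) ∈ range I := (hψ _ hp.2).1 (angles_mem_liftedDomain a p)
    simp only [mem_ofPred_eq, I.right_inv h1, ψ.left_inv hp.2]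
    exact ⟨ψ.map_source hp.2, abs_angles_sub_lt hp.1⟩
  map_target' q hq := by
    have h1 : ψ.symm (I q) ∈ liftedDomain R := by
      rw [hψ _ (ψ.map_target hq.1), ψ.right_inv hq.1]; exact mem_range_self q
    simp only [mem_ofPred_eq, apply_invFun_torusExp h1, angles_torusExp hq.2]
    exact ⟨torusExp_mem_branchDomain hq.2, ψ.map_target hq.1⟩
  left_inv' p hp := by
    have h1 : ψ (angles a (R p)) ∈ range I := (hψ _ hp.2).1 (angles_mem_liftedDomain a p)
    rw [I.right_inv h1, ψ.left_inv hp.2, torusExp_angles]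
    exact Function.leftInverse_invFun hR.injective p
  right_inv' q hq := by
    have h1 : ψ.symm (I q) ∈ liftedDomain R := by
      rw [hψ _ (ψ.map_target hq.1), ψ.right_inv hq.1]; exact mem_range_self q
    rw [apply_invFun_torusExp h1, angles_torusExp hq.2, ψ.right_inv hq.1, I.left_inv]
  open_source := by
    have h1 : ContinuousOn (fun p => angles a (R p)) (R ⁻¹' branchDomain a) :=
      (continuousOn_angles a).comp hR.continuous.continuousOn (mapsTo_preimage _ _)
    exact h1.isOpen_inter_preimage ((isOpen_branchDomain a).preimage hR.continuous) ψ.open_source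
  open_target := by
    have h1 : ContinuousOn (fun q => ψ.symm (I q)) (I ⁻¹' ψ.target) :=
      ψ.continuousOn_symm.comp I.continuous.continuousOn (mapsTo_preimage _ _)
    have h2 : IsOpen {x : EuclideanSpace ℝ (Fin D) | ∀ j, |x j - a j| < Real.pi} := by
      simp only [ofPred_forall]
      exact isOpen_iInter_of_finite fun j => isOpen_lt (by fun_prop) continuous_const
    exact h1.isOpen_inter_preimage (ψ.open_target.preimage I.continuous) h2
  continuousOn_toFun :=
    I.continuous_symm.comp_continuousOn (ψ.continuousOn.comp
      ((continuousOn_angles a).comp hR.continuous.continuousOn fun _ hp => hp.1) fun _ hp => hp.2)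
  continuousOn_invFun := by
    refine (continuousOn_of_apply_eq hR fun x hx => apply_invFun_torusExp hx).comp
      (ψ.continuousOn_symm.comp I.continuous.continuousOn fun q hq => hq.1) fun q hq => ?_
    rw [hψ _ (ψ.map_target hq.1), ψ.right_inv hq.1]; exact mem_range_self q

/-- A subset of the torus that is locally straightened to the range of `I` is a manifold. -/
theorem exists_toral_chartedSpace (hR : IsEmbedding R)
    (hψ : ∀ x ∈ liftedDomain R, ∃ ψ, IsStraightenedAt I (liftedDomain R) x ψ) :
    ∃ _ : ChartedSpace H M, IsManifold I ∞ M ∧ IsToral I R := by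
  classical
  rcases isEmpty_or_nonempty M with hM | hM
  · refine ⟨ChartedSpace.empty H M, ?_, fun p => hM.elim p, fun F hF x hx => hM.elim (F x)⟩
    let _ := ChartedSpace.empty H M
    infer_instance
  have : Nonempty (OpenPartialHomeomorph (EuclideanSpace ℝ (Fin D)) (EuclideanSpace ℝ (Fin D))) :=
    ⟨OpenPartialHomeomorph.refl _⟩
  choose! ψ hψ using hψ
  let ctr (p : M) : EuclideanSpace ℝ (Fin D) := angles 0 (R p)
  have hctr (p : M) : IsStraightenedAt I (liftedDomain R) (ctr p) (ψ (ctr p)) :=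
    hψ _ (angles_mem_liftedDomain 0 p)
  let ch (p : M) : OpenPartialHomeomorph M H := toralChart I hR (ctr p) (ψ (ctr p)) (hctr p).2.2.2
  have hself (p : M) : angles (ctr p) (R p) = ctr p := by
    have := angles_torusExp (a := ctr p) (x := ctr p) fun j => by simp [Real.pi_pos]
    rwa [torusExp_angles] at this
  have hbr (p : M) : R p ∈ branchDomain (ctr p) := by
    have := torusExp_mem_branchDomain_self (ctr p)
    rwa [torusExp_angles] at this
  have hmem (p : M) : p ∈ (ch p).source := ⟨hbr p, by rw [hself]; exact (hctr p).1⟩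
  let cs : ChartedSpace H M :=
    { atlas := range ch
      chartAt := ch
      mem_chart_source := hmem
      chart_mem_atlas := mem_range_self }
  have htarget {p : M} {v : EuclideanSpace ℝ (Fin D)} (hv : v ∈ range I)
      (hv' : v ∈ (ψ (ctr p)).target) : (ψ (ctr p)).symm v ∈ liftedDomain R := by
    rw [(hctr p).2.2.2 _ ((ψ (ctr p)).map_target hv'), (ψ (ctr p)).right_inv hv']; exact hv
  refine ⟨cs, isManifold_of_contDiffOn I ∞ M ?_, ?_, ?_⟩
  -- In the model, a change of charts is `ψ' ∘ angles ∘ torusExp ∘ ψ⁻¹`. Each factor is smooth on an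
  -- open set, and `key` checks that the points of the overlap lie in these sets.
  · rintro _ _ ⟨p, rfl⟩ ⟨p', rfl⟩
    have key : ∀ v ∈ I.symm ⁻¹' ((ch p).symm ≫ₕ ch p').source ∩ range I,
        v ∈ (ψ (ctr p)).target ∧ torusExp ((ψ (ctr p)).symm v) ∈ branchDomain (ctr p') ∧
        angles (ctr p') (torusExp ((ψ (ctr p)).symm v)) ∈ (ψ (ctr p')).source := by
      rintro v ⟨hv, hvI⟩
      simp only [OpenPartialHomeomorph.trans_source, OpenPartialHomeomorph.symm_source,
        mem_preimage, mem_inter_iff] at hv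
      obtain ⟨⟨h1, -⟩, h2, h3⟩ := hv
      rw [I.right_inv hvI] at h1
      have h4 : R ((ch p).symm (I.symm v)) = torusExp ((ψ (ctr p)).symm v) := by
        have := apply_invFun_torusExp (htarget hvI h1)
        rw [← this]
        change R (Function.invFun R (torusExp ((ψ (ctr p)).symm (I (I.symm v))))) = _
        rw [I.right_inv hvI]
      rw [h4] at h2 h3
      exact ⟨h1, h2, h3⟩
    refine ContDiffOn.congr (f := fun v => ψ (ctr p') (angles (ctr p')
      (torusExp ((ψ (ctr p)).symm v)))) ?_ ?_
    · refine (hctr p').2.1.comp (fun v hv => ?_) fun v hv => (key v hv).2.2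
      refine (contDiffAt_angles_torusExp (key v hv).2.1).comp_contDiffWithinAt v ?_
      exact ((hctr p).2.2.1 v (key v hv).1).mono fun w hw => (key w hw).1
    · intro v hv
      change I (I.symm (ψ (ctr p') (angles (ctr p') (R (Function.invFun R (torusExp
        ((ψ (ctr p)).symm (I (I.symm v))))))))) = _
      rw [I.right_inv hv.2, apply_invFun_torusExp (htarget hv.2 (key v hv).1)]
      refine I.right_inv (((hctr p').2.2.2 _ (key v hv).2.2).1 ?_)
      obtain ⟨q, hq⟩ := htarget hv.2 (key v hv).1
      rw [← hq]
      exact angles_mem_liftedDomain _ q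
  · intro p a hp
    rw [contMDiffAt_iff]
    have hext : extChartAt I p p = ψ (ctr p) (ctr p) := by
      change I (I.symm (ψ (ctr p) (angles (ctr p) (R p)))) = _
      rw [hself]
      refine I.right_inv (((hctr p).2.2.2 _ (hctr p).1).1 (angles_mem_liftedDomain 0 p))
    refine ⟨((continuousOn_angles a).continuousAt ((isOpen_branchDomain a).mem_nhds hp)).comp
      hR.continuous.continuousAt, ?_⟩
    rw [hext]
    have hopen : (ψ (ctr p)).target ∈ 𝓝[range I] (ψ (ctr p) (ctr p)) :=
      mem_nhdsWithin_of_mem_nhds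
        ((ψ (ctr p)).open_target.mem_nhds ((ψ (ctr p)).map_source (hctr p).1))
    have heq : ∀ v ∈ range I, v ∈ (ψ (ctr p)).target →
        angles a (R ((extChartAt I p).symm v)) = angles a (torusExp ((ψ (ctr p)).symm v)) := by
      intro v hv hv'
      change angles a (R (Function.invFun R (torusExp ((ψ (ctr p)).symm (I (I.symm v)))))) = _
      rw [I.right_inv hv, apply_invFun_torusExp (htarget hv hv')]
    refine ContDiffWithinAt.congr_of_eventuallyEq
      (f := fun v => angles a (torusExp ((ψ (ctr p)).symm v))) ?_ ?_ ?_
    · refine ContDiffAt.contDiffWithinAt ?_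
      refine (contDiffAt_angles_torusExp (x := (ψ (ctr p)).symm (ψ (ctr p) (ctr p))) ?_).comp _ ?_
      · rw [(ψ (ctr p)).left_inv (hctr p).1, torusExp_angles]; exact hp
      · exact (hctr p).2.2.1.contDiffAt
          ((ψ (ctr p)).open_target.mem_nhds ((ψ (ctr p)).map_source (hctr p).1))
    · filter_upwards [hopen, self_mem_nhdsWithin] with v hv hv'
      exact heq v hv' hv
    · exact heq _ (((hctr p).2.2.2 _ (hctr p).1).1 (angles_mem_liftedDomain 0 p))
        ((ψ (ctr p)).map_source (hctr p).1)
  · intro F hF x hx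
    rw [contMDiffWithinAt_iff]
    refine ⟨continuousOn_of_apply_eq hR hF x hx, ?_⟩
    simp only [extChartAt_model_space_eq_id, PartialEquiv.refl_symm, PartialEquiv.refl_coe,
      Function.comp_id, modelWithCornersSelf_coe, range_id, inter_univ, preimage_id, id_eq]
    have hbr' : torusExp x ∈ branchDomain (ctr (F x)) := by rw [← hF x hx]; exact hbr _
    have hval : angles (ctr (F x)) (torusExp x) = ctr (F x) := by rw [← hF x hx, hself]
    have hcd := contDiffAt_angles_torusExp hbr'
    have hsrc : (ψ (ctr (F x))).source ∈ 𝓝 (ctr (F x)) :=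
      (ψ (ctr (F x))).open_source.mem_nhds (hctr _).1
    have hev : ∀ᶠ y in 𝓝[liftedDomain R] x,
        angles (ctr (F x)) (torusExp y) ∈ (ψ (ctr (F x))).source := by
      refine nhdsWithin_le_nhds (hcd.continuousAt.preimage_mem_nhds ?_)
      simp only [hval]; exact hsrc
    have heq : ∀ y ∈ liftedDomain R, angles (ctr (F x)) (torusExp y) ∈ (ψ (ctr (F x))).source →
        (extChartAt I (F x) ∘ F) y = ψ (ctr (F x)) (angles (ctr (F x)) (torusExp y)) := by
      intro y hy hy'
      change I (I.symm (ψ (ctr (F x)) (angles (ctr (F x)) (R (F y))))) = _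
      rw [hF y hy]
      refine I.right_inv (((hctr _).2.2.2 _ hy').1 ?_)
      rw [← hF y hy]
      exact angles_mem_liftedDomain _ _
    refine ContDiffWithinAt.congr_of_eventuallyEq
      (f := fun y => ψ (ctr (F x)) (angles (ctr (F x)) (torusExp y))) ?_ ?_ ?_
    · refine ContDiffAt.contDiffWithinAt (ContDiffAt.comp x ?_ hcd)
      rw [hval]
      exact (hctr _).2.1.contDiffAt hsrc
    · filter_upwards [hev, self_mem_nhdsWithin] with y hy hy'
      exact heq y hy' hy
    · exact heq x hx (by rw [hval]; exact (hctr _).1)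

variable {I}

/-- Smoothness can be tested on the covering. As `hf` covers every lift of `R p`, near each point
the branch of the angles may be centred there. -/
theorem IsToral.contMDiff_of_eq [ChartedSpace H M] (h : IsToral I R)
    {E' H' N : Type*} [NormedAddCommGroup E'] [NormedSpace ℝ E'] [TopologicalSpace H']
    {J : ModelWithCorners ℝ E' H'} [TopologicalSpace N] [ChartedSpace H' N]
    {f : M → N} {F : EuclideanSpace ℝ (Fin D) → N}
    (hF : ContMDiffOn 𝓘(ℝ, EuclideanSpace ℝ (Fin D)) J ∞ F (liftedDomain R))
    (hf : ∀ p x, R p = torusExp x → f p = F x) : ContMDiff I J ∞ f := by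
  intro p
  obtain ⟨a, ha⟩ := torusExp_surjective (R p)
  have h1 : f = fun p => F (angles a (R p)) := funext fun p => hf p _ (torusExp_angles _ _).symm
  rw [h1]
  have h2 := h.1 p a (by rw [← ha]; exact torusExp_mem_branchDomain_self a)
  exact contMDiffWithinAt_univ.1 ((hF _ (angles_mem_liftedDomain a p)).comp p
    h2.contMDiffWithinAt fun q _ => angles_mem_liftedDomain a q)

end ToralDomain

/-! ### Straightening regular level sets -/

section Straightening

/-- Take the adjoint of an automorphism `A` that sends `e₀` to the vector `g` representing `L`: then
`⟪e₀, A* y⟫ = ⟪g, y⟫ = L y`. -/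
theorem exists_equiv_apply_zero_eq {D : ℕ} {L : EuclideanSpace ℝ (Fin (D + 1)) →L[ℝ] ℝ}
    (hL : L ≠ 0) :
    ∃ T : EuclideanSpace ℝ (Fin (D + 1)) ≃L[ℝ] EuclideanSpace ℝ (Fin (D + 1)),
      ∀ y, T y 0 = L y := by
  set g := (InnerProductSpace.toDual ℝ (EuclideanSpace ℝ (Fin (D + 1)))).symm L with hg
  have hg0 : g ≠ 0 := by simpa [hg] using hL
  have he0 : (EuclideanSpace.single 0 1 : EuclideanSpace ℝ (Fin (D + 1))) ≠ 0 := by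
    intro h
    have := congrArg (fun v : EuclideanSpace ℝ (Fin (D + 1)) => v 0) h
    simp at this
  obtain ⟨A, hA⟩ := SeparatingDual.exists_continuousLinearEquiv_apply_eq (R := ℝ) he0 hg0
  let A' := A.toContinuousLinearMap
  let B' := A.symm.toContinuousLinearMap
  have h1 : A' ∘L B' = ContinuousLinearMap.id ℝ _ := by ext1 v; exact A.apply_symm_apply v
  have h2 : B' ∘L A' = ContinuousLinearMap.id ℝ _ := by ext1 v; exact A.symm_apply_apply v
  refine ⟨ContinuousLinearEquiv.equivOfInverse (ContinuousLinearMap.adjoint A')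
    (ContinuousLinearMap.adjoint B') (fun v => ?_) (fun v => ?_), fun y => ?_⟩
  · rw [← ContinuousLinearMap.comp_apply, ← ContinuousLinearMap.adjoint_comp, h1,
      ContinuousLinearMap.adjoint_id]; rfl
  · rw [← ContinuousLinearMap.comp_apply, ← ContinuousLinearMap.adjoint_comp, h2,
      ContinuousLinearMap.adjoint_id]; rfl
  · have h3 : inner ℝ (EuclideanSpace.single 0 1) (ContinuousLinearMap.adjoint A' y) = L y := by
      rw [ContinuousLinearMap.adjoint_inner_right]
      change inner ℝ (A _) y = L y
      rw [hA, hg, InnerProductSpace.toDual_symm_apply]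
    rw [← h3, EuclideanSpace.inner_single_left]
    simp

theorem range_boundaryModel_succ (D : ℕ) :
    range (boundaryModel (D + 1)) = {y | 0 ≤ y 0} :=
  range_modelWithCornersEuclideanHalfSpace (D + 1)

theorem exists_straightening_of_eventually {D : ℕ} {W : Set (EuclideanSpace ℝ (Fin (D + 1)))}
    {x : EuclideanSpace ℝ (Fin (D + 1))} {g : EuclideanSpace ℝ (Fin (D + 1)) → ℝ}
    (hg : ContDiff ℝ ∞ g) (hgx : fderiv ℝ g x ≠ 0) (hW : ∀ᶠ y in 𝓝 x, y ∈ W ↔ 0 ≤ g y) :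
    ∃ ψ, IsStraightenedAt (boundaryModel (D + 1)) W x ψ := by
  obtain ⟨T, hT⟩ := exists_equiv_apply_zero_eq hgx
  let e₀ : EuclideanSpace ℝ (Fin (D + 1)) := EuclideanSpace.single 0 1
  -- The correction along `e₀` makes the first coordinate equal to `g` itself while the derivative
  -- at `x` remains `T`.
  let φ : EuclideanSpace ℝ (Fin (D + 1)) → EuclideanSpace ℝ (Fin (D + 1)) :=
    fun y => T y + (g y - fderiv ℝ g x y) • e₀
  have hφ : ContDiff ℝ ∞ φ :=
    T.contDiff.add ((hg.sub (fderiv ℝ g x).contDiff).smul contDiff_const)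
  have hφ0 (y) : φ y 0 = g y := by simp [φ, e₀, hT]
  have hder : HasFDerivAt φ (T : EuclideanSpace ℝ (Fin (D + 1)) →L[ℝ] _) x := by
    have h1 := T.hasFDerivAt.add ((((hg.differentiable (by simp) x).hasFDerivAt).sub
      (fderiv ℝ g x).hasFDerivAt).smul_const e₀) (x := x)
    refine h1.congr_fderiv ?_
    ext1 v
    simp
  -- The inverse has to be smooth on the whole target, so the source is cut down to points with
  -- invertible derivative.
  let U := {y | fderiv ℝ φ y ∈ range (fun T : EuclideanSpace ℝ (Fin (D + 1)) ≃L[ℝ]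
    EuclideanSpace ℝ (Fin (D + 1)) => (T : EuclideanSpace ℝ (Fin (D + 1)) →L[ℝ] _))}
  have hU : IsOpen U := ContinuousLinearEquiv.isOpen.preimage (hφ.continuous_fderiv (by simp))
  obtain ⟨S, hSW, hS, hxS⟩ := eventually_nhds_iff.1 hW
  let ψ₀ := hφ.contDiffAt.toOpenPartialHomeomorph φ hder (by simp)
  have hx₀ : x ∈ ψ₀.source := hφ.contDiffAt.mem_toOpenPartialHomeomorph_source hder (by simp)
  let ψ := ψ₀.restrOpen (U ∩ S) (hU.inter hS)
  have hcoe (y) : ψ y = φ y := rfl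
  refine ⟨ψ, ⟨hx₀, ⟨T, hder.fderiv.symm⟩, hxS⟩, hφ.contDiffOn, fun z hz => ?_, fun y hy => ?_⟩
  · obtain ⟨T', hT'⟩ := (ψ.map_target hz).2.1
    refine (ψ.contDiffAt_symm (f₀' := T') hz ?_ hφ.contDiffAt).contDiffWithinAt
    exact (hφ.differentiable (by simp) _).hasFDerivAt.congr_fderiv hT'.symm
  · rw [hSW y hy.2.2, range_boundaryModel_succ]
    simp only [mem_ofPred_eq, hcoe, hφ0]

/-- A domain that is bounded by regular level sets can be straightened. -/
theorem exists_straightening {D : ℕ} {h : EuclideanSpace ℝ (Fin D) → ℝ} (hh : ContDiff ℝ ∞ h)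
    {a b : ℝ} (hab : a < b) (hreg : ∀ x, h x = a ∨ h x = b → fderiv ℝ h x ≠ 0)
    {x : EuclideanSpace ℝ (Fin D)} (hx : x ∈ h ⁻¹' Icc a b) :
    ∃ ψ, IsStraightenedAt (boundaryModel D) (h ⁻¹' Icc a b) x ψ := by
  cases D with
  | zero =>
    refine ⟨OpenPartialHomeomorph.refl _, mem_univ _, contDiff_id.contDiffOn,
      contDiff_id.contDiffOn, fun y _ => ?_⟩
    rw [Subsingleton.elim y x]
    exact iff_of_true hx ⟨x, rfl⟩
  | succ D =>
    rcases hx.1.eq_or_lt with h1 | h1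
    · refine exists_straightening_of_eventually (g := fun y => h y - a) (hh.sub contDiff_const) ?_ ?_
      · rw [fderiv_sub_const]; exact hreg x (.inl h1.symm)
      · filter_upwards [hh.continuous.continuousAt.eventually_lt continuousAt_const
          (show h x < b by rw [← h1]; exact hab)] with y hy
        simp only [mem_preimage, mem_Icc, sub_nonneg, and_iff_left_iff_imp]
        exact fun _ => hy.le
    · rcases hx.2.eq_or_lt with h2 | h2
      · refine exists_straightening_of_eventually (g := fun y => b - h y)
          (contDiff_const.sub hh) ?_ ?_
        · rw [fderiv_const_sub, neg_ne_zero]; exact hreg x (.inr h2)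
        · filter_upwards [continuousAt_const.eventually_lt hh.continuous.continuousAt h1] with y hy
          simp only [mem_preimage, mem_Icc, sub_nonneg, and_iff_right_iff_imp]
          exact fun _ => hy.le
      -- At an interior point any regular function that is positive near `x` will do: the summand
      -- `1` places `x` inside the half-space.
      · have hg : ContDiff ℝ ∞ fun y : EuclideanSpace ℝ (Fin (D + 1)) => y 0 - x 0 + 1 := by
          fun_prop
        refine exists_straightening_of_eventually hg ?_ ?_
        · intro h0
          have h3 : HasFDerivAt (fun y : EuclideanSpace ℝ (Fin (D + 1)) => y 0 - x 0 + 1)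
              (EuclideanSpace.proj (0 : Fin (D + 1)) : _ →L[ℝ] ℝ) x :=
            ((EuclideanSpace.proj (0 : Fin (D + 1)) : EuclideanSpace ℝ (Fin (D + 1)) →L[ℝ]
              ℝ).hasFDerivAt.sub_const (x 0)).add_const 1
          rw [h3.fderiv] at h0
          have := congrArg (fun L : EuclideanSpace ℝ (Fin (D + 1)) →L[ℝ] ℝ =>
            L (EuclideanSpace.single 0 1)) h0
          simp at this
        · filter_upwards [hh.continuous.continuousAt.eventually_lt continuousAt_const h2,
            continuousAt_const.eventually_lt hh.continuous.continuousAt h1,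
            continuousAt_const.eventually_lt hg.continuous.continuousAt
              (show (0 : ℝ) < x 0 - x 0 + 1 by simp)] with y hy1 hy2 hy3
          exact iff_of_true ⟨hy2.le, hy1.le⟩ hy3.le

end Straightening

/-! ### Critical points of the length of an arm -/

section Arm

variable {m : ℕ}

/-- The end of the arm with bars `c j` in the directions `u j`, followed by the bar `b` in the
direction `1`. -/
def armEnd (c : Fin m → ℝ) (b : ℝ) (u : Fin m → Circle) : ℂ := ∑ j, (c j : ℂ) * u j + b

theorem contDiff_coe_torusExp (j : Fin m) :
    ContDiff ℝ ∞ fun x : EuclideanSpace ℝ (Fin m) => (torusExp x j : ℂ) := by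
  simp only [torusExp, Circle.coe_exp]
  have h1 : ContDiff ℝ ∞ fun y : EuclideanSpace ℝ (Fin m) => ((y j : ℝ) : ℂ) :=
    Complex.ofRealCLM.contDiff.comp (by fun_prop)
  exact (h1.mul contDiff_const).cexp

theorem contDiff_armEnd (c : Fin m → ℝ) (b : ℝ) :
    ContDiff ℝ ∞ fun x : EuclideanSpace ℝ (Fin m) => armEnd c b (torusExp x) :=
  (ContDiff.sum fun j _ => contDiff_const.mul (contDiff_coe_torusExp j)).add contDiff_const

/-- Turning the bar `j` moves the end `S` with velocity `i c j u j`, and `2 Re (conj S * i c j u j)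
= -2 c j Im (conj S * u j)`. -/
theorem fderiv_normSq_armEnd (c : Fin m → ℝ) (b : ℝ) (x : EuclideanSpace ℝ (Fin m)) (j : Fin m) :
    fderiv ℝ (fun x => ‖armEnd c b (torusExp x)‖ ^ 2) x (EuclideanSpace.single j 1) =
      -2 * c j * (starRingEnd ℂ (armEnd c b (torusExp x)) * torusExp x j).im := by
  have hpath : HasDerivAt (fun s : ℝ => x + s • EuclideanSpace.single j (1 : ℝ))
      (EuclideanSpace.single j (1 : ℝ)) 0 := by
    simpa using ((hasDerivAt_id (0 : ℝ)).smul_const (EuclideanSpace.single j (1 : ℝ))).const_add x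
  have hterm (k : Fin m) : HasDerivAt (fun s : ℝ =>
      (c k : ℂ) * torusExp (x + s • EuclideanSpace.single j (1 : ℝ)) k)
      (if k = j then (c j : ℂ) * (torusExp x j * Complex.I) else 0) 0 := by
    by_cases hk : k = j
    · subst hk
      have h1 : HasDerivAt (fun s : ℝ => ((x k + s : ℝ) : ℂ) * Complex.I) (1 * Complex.I) 0 := by
        have := ((hasDerivAt_id (0 : ℝ)).const_add (x k)).ofReal_comp.mul_const Complex.I
        simpa using this
      have h2 := (h1.cexp).const_mul (c k : ℂ)
      simpa [torusExp, -Circle.exp_add] using h2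
    · simpa [torusExp, hk] using hasDerivAt_const (0 : ℝ) ((c k : ℂ) * torusExp x k)
  have hsum : HasDerivAt (fun s : ℝ => armEnd c b (torusExp
      (x + s • EuclideanSpace.single j (1 : ℝ)))) ((c j : ℂ) * (torusExp x j * Complex.I)) 0 := by
    have := (HasDerivAt.fun_sum fun k (_ : k ∈ Finset.univ) => hterm k).add_const (b : ℂ)
    simpa [armEnd] using this
  have h1 := hsum.norm_sq
  have hd : DifferentiableAt ℝ (fun x => ‖armEnd c b (torusExp x)‖ ^ 2)
      (x + (0 : ℝ) • EuclideanSpace.single j (1 : ℝ)) :=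
    ((contDiff_armEnd c b).norm_sq ℝ).differentiable (by simp) _
  have h2 := hd.hasFDerivAt.comp_hasDerivAt (0 : ℝ) hpath
  have h3 := h2.unique h1
  simp only [zero_smul, add_zero] at h3
  rw [h3, Complex.inner]
  simp only [Complex.mul_re, Complex.mul_im, Complex.I_re, Complex.I_im, Complex.ofReal_re,
    Complex.ofReal_im, Complex.conj_re, Complex.conj_im]
  ring

theorem eq_or_eq_neg_norm_of_im_eq_zero {z : ℂ} (hz : z.im = 0) :
    z = (‖z‖ : ℂ) ∨ z = -(‖z‖ : ℂ) := by
  have h1 : z = (z.re : ℂ) := Complex.ext rfl (by simp [hz])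
  have h2 : ‖z‖ = |z.re| := by rw [h1]; simp
  rcases abs_choice z.re with h | h
  · left; rw [h2, h]; exact h1
  · right; rw [h2, h, Complex.ofReal_neg, neg_neg]; exact h1

/-- At a critical point of the distance between its ends an arm is straight. -/
theorem exists_signs_of_critical (c : Fin m → ℝ) {b : ℝ} (hb : b ≠ 0)
    (x : EuclideanSpace ℝ (Fin m)) (hS : armEnd c b (torusExp x) ≠ 0)
    (hd : ∀ j, fderiv ℝ (fun x => ‖armEnd c b (torusExp x)‖ ^ 2) x
      (EuclideanSpace.single j 1) = 0) :
    ∃ (ε : Fin m → ℝ) (ε' : ℝ), IsSign ε ∧ (ε' = 1 ∨ ε' = -1) ∧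
      ∑ j, ε j * c j + ε' * b = ‖armEnd c b (torusExp x)‖ := by
  set S := armEnd c b (torusExp x) with hSdef
  have hn : ‖S‖ ≠ 0 := norm_ne_zero_iff.2 hS
  have h1 (j : Fin m) : ∃ e : ℝ, (e = 1 ∨ e = -1) ∧
      (c j : ℂ) * (starRingEnd ℂ S * torusExp x j) = ((e * c j * ‖S‖ : ℝ) : ℂ) := by
    -- A bar of length zero imposes no condition and may take any sign. This case occurs when the
    -- first bar is shrunk to a point.
    by_cases hc : c j = 0
    · exact ⟨1, .inl rfl, by simp [hc]⟩
    have h2 := hd j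
    rw [fderiv_normSq_armEnd] at h2
    have h3 : (starRingEnd ℂ S * torusExp x j).im = 0 := by
      rcases mul_eq_zero.1 h2 with h | h
      · exact absurd h (by simp [hc])
      · exact h
    have h4 : ‖starRingEnd ℂ S * torusExp x j‖ = ‖S‖ := by simp [Circle.norm_coe]
    rcases eq_or_eq_neg_norm_of_im_eq_zero h3 with h | h
    · exact ⟨1, .inl rfl, by rw [h, h4]; push_cast; ring⟩
    · exact ⟨-1, .inr rfl, by rw [h, h4]; push_cast; ring⟩
  choose ε hε hεc using h1
  -- The bar `b` cannot turn, so its parallelism to `S` is deduced: expanding `conj S * S` shows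
  -- that `b * conj S` is real.
  have h5 : (b : ℂ) * starRingEnd ℂ S = ((‖S‖ ^ 2 - ∑ j, ε j * c j * ‖S‖ : ℝ) : ℂ) := by
    have h6 : starRingEnd ℂ S * S = ((‖S‖ ^ 2 : ℝ) : ℂ) := by
      rw [mul_comm, Complex.mul_conj, Complex.normSq_eq_norm_sq]
    have h7 : starRingEnd ℂ S * S = ∑ j, (c j : ℂ) * (starRingEnd ℂ S * torusExp x j) +
        (b : ℂ) * starRingEnd ℂ S := by
      have (w : ℂ) : w * S = ∑ j, (c j : ℂ) * (w * torusExp x j) + (b : ℂ) * w := by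
        simp only [hSdef, armEnd, mul_add, Finset.mul_sum, mul_comm w (b : ℂ), mul_left_comm w]
      exact this _
    rw [h6] at h7
    simp only [hεc] at h7
    push_cast at h7 ⊢
    rw [h7]; ring
  have h8 : (starRingEnd ℂ S).im = 0 := by
    have := congrArg Complex.im h5
    rw [Complex.ofReal_im, Complex.im_ofReal_mul] at this
    exact (mul_eq_zero.1 this).resolve_left hb
  have h9 : ∃ e : ℝ, (e = 1 ∨ e = -1) ∧ starRingEnd ℂ S = ((e * ‖S‖ : ℝ) : ℂ) := by
    rcases eq_or_eq_neg_norm_of_im_eq_zero h8 with h | h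
    · exact ⟨1, .inl rfl, by rw [h]; simp⟩
    · exact ⟨-1, .inr rfl, by rw [h]; simp⟩
  obtain ⟨ε', hε', h10⟩ := h9
  refine ⟨ε, ε', hε, hε', ?_⟩
  rw [h10, ← Complex.ofReal_mul, Complex.ofReal_inj] at h5
  have h11 : (∑ j, ε j * c j + ε' * b) * ‖S‖ = ‖S‖ * ‖S‖ := by
    rw [← Finset.sum_mul] at h5
    linear_combination h5
  exact mul_right_cancel₀ hn h11

end Arm

/-! ### The configuration space as a domain of the torus -/

namespace MetricData

variable {D : ℕ} (A : MetricData D)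

theorem mem_configs_iff (z : Fin (D + 2) → ℂ) :
    z ∈ A.configs ↔ (∀ i : Fin (D + 1), ‖z i.succ - z i.castSucc‖ = A.leg i) ∧
      ‖z 0 - z (Fin.last (D + 1))‖ ∈ Icc A.lo A.hi := by
  simp only [configs, mem_preimage, mem_Icc, Pi.le_def, Fin.forall_fin_succ' (n := D + 1), lower,
    upper, Fin.snoc_castSucc, Fin.snoc_last, sideLengths, Fin.coeSucc_eq_succ, Fin.last_add_one]
  constructor
  · rintro ⟨⟨h1, h2⟩, h3, h4⟩
    exact ⟨fun i => le_antisymm (h3 i) (h1 i), h2, h4⟩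
  · rintro ⟨h1, h2, h3⟩
    exact ⟨⟨fun i => (h1 i).ge, h2⟩, fun i => (h1 i).le, h3⟩

/-- The unit vector in the direction of a bar. -/
def barDir (z : Fin (D + 2) → ℂ) (i : Fin (D + 1)) : ℂ := (z i.succ - z i.castSucc) / A.leg i

theorem leg_ne_zero (i : Fin (D + 1)) : (A.leg i : ℂ) ≠ 0 :=
  Complex.ofReal_ne_zero.2 (A.leg_pos i).ne'

theorem norm_barDir {z : Fin (D + 2) → ℂ} (hz : z ∈ A.configs) (i : Fin (D + 1)) :
    ‖A.barDir z i‖ = 1 := by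
  rw [barDir, norm_div, ((A.mem_configs_iff z).1 hz).1 i, Complex.norm_real,
    Real.norm_of_nonneg (A.leg_pos i).le, div_self (A.leg_pos i).ne']

theorem leg_mul_barDir (z : Fin (D + 2) → ℂ) (i : Fin (D + 1)) :
    (A.leg i : ℂ) * A.barDir z i = z i.succ - z i.castSucc :=
  mul_div_cancel₀ _ (A.leg_ne_zero i)

theorem contDiff_barDir (i : Fin (D + 1)) : ContDiff ℝ ∞ fun z => A.barDir z i := by
  unfold barDir
  simp only [div_eq_mul_inv]
  fun_prop

/-- The direction of a bar relative to the last fixed bar. -/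
def relDir (z : Fin (D + 2) → ℂ) (j : Fin D) : ℂ :=
  A.barDir z j.castSucc / A.barDir z (Fin.last D)

theorem norm_relDir {z : Fin (D + 2) → ℂ} (hz : z ∈ A.configs) (j : Fin D) :
    ‖A.relDir z j‖ = 1 := by
  rw [relDir, norm_div, A.norm_barDir hz, A.norm_barDir hz, div_one]

theorem barDir_ne_zero {z : Fin (D + 2) → ℂ} (hz : z ∈ A.configs) (i : Fin (D + 1)) :
    A.barDir z i ≠ 0 := norm_ne_zero_iff.1 (by rw [A.norm_barDir hz]; exact one_ne_zero)

theorem contDiffAt_relDir {z : Fin (D + 2) → ℂ} (hz : z ∈ A.configs) (j : Fin D) :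
    ContDiffAt ℝ ∞ (fun z => A.relDir z j) z := by
  unfold relDir
  simp only [div_eq_mul_inv]
  exact (A.contDiff_barDir _).contDiffAt.mul
    ((A.contDiff_barDir _).contDiffAt.inv (A.barDir_ne_zero hz _))

/-- The shape of a configuration: the directions of the bars relative to the last fixed bar. -/
def configShape (z : A.configs) (j : Fin D) : Circle :=
  ⟨A.relDir z j, mem_sphere_zero_iff_norm.2 (A.norm_relDir z.2 j)⟩

theorem coe_configShape (z : A.configs) (j : Fin D) : (A.configShape z j : ℂ) = A.relDir z j := rfl

theorem continuous_configShape : Continuous A.configShape := by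
  refine continuous_pi fun j => Continuous.subtype_mk ?_ _
  exact continuous_iff_continuousAt.2 fun z =>
    (A.contDiffAt_relDir z.2 j).continuousAt.comp continuousAt_subtype_val

/-- The configuration of given shape whose last fixed bar has direction `1`. -/
def shapeConfig (u : Fin D → Circle) (i : Fin (D + 2)) : ℂ :=
  ∑ j : Fin (D + 1), if j.castSucc < i then
    A.leg j * (Fin.snoc (fun k => (u k : ℂ)) 1 : Fin (D + 1) → ℂ) j else 0

theorem shapeConfig_zero (u : Fin D → Circle) : A.shapeConfig u 0 = 0 := by
  simp [shapeConfig]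

theorem shapeConfig_succ (u : Fin D → Circle) (i : Fin (D + 1)) :
    A.shapeConfig u i.succ - A.shapeConfig u i.castSucc =
      A.leg i * (Fin.snoc (fun k => (u k : ℂ)) 1 : Fin (D + 1) → ℂ) i := by
  rw [shapeConfig, shapeConfig, ← Finset.sum_sub_distrib, Finset.sum_eq_single i]
  · simp
  · intro j _ hj
    have h1 : j.castSucc < i.succ ↔ j.castSucc < i.castSucc := by
      rw [Fin.castSucc_lt_succ_iff, Fin.castSucc_lt_castSucc_iff, le_iff_lt_or_eq,
        or_iff_left hj]
    simp [h1]
  · simp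

/-- The endpoint of the chain of fixed bars. -/
def chainEnd (u : Fin D → Circle) : ℂ :=
  armEnd (fun j => A.leg j.castSucc) (A.leg (Fin.last D)) u

theorem shapeConfig_last (u : Fin D → Circle) :
    A.shapeConfig u (Fin.last (D + 1)) = A.chainEnd u := by
  simp [shapeConfig, chainEnd, armEnd, Fin.sum_univ_castSucc, Fin.castSucc_lt_last]

theorem shapeConfig_mem_iff (u : Fin D → Circle) :
    A.shapeConfig u ∈ A.configs ↔ ‖A.chainEnd u‖ ∈ Icc A.lo A.hi := by
  rw [mem_configs_iff, shapeConfig_zero, shapeConfig_last, zero_sub, norm_neg,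
    and_iff_right_iff_imp]
  intro _ i
  rw [shapeConfig_succ, norm_mul, Complex.norm_real, Real.norm_of_nonneg (A.leg_pos i).le]
  induction i using Fin.lastCases with
  | last => simp
  | cast i => simp [Circle.norm_coe]

theorem configShape_shapeConfig {u : Fin D → Circle} (hu : A.shapeConfig u ∈ A.configs) :
    A.configShape ⟨_, hu⟩ = u := by
  funext j
  apply Circle.ext
  rw [coe_configShape, relDir, barDir, barDir, shapeConfig_succ, shapeConfig_succ,
    mul_div_cancel_left₀ _ (A.leg_ne_zero _), mul_div_cancel_left₀ _ (A.leg_ne_zero _)]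
  simp

theorem continuous_coe_snoc (j : Fin (D + 1)) : Continuous fun u : Fin D → Circle =>
    (Fin.snoc (fun k => (u k : ℂ)) 1 : Fin (D + 1) → ℂ) j := by
  induction j using Fin.lastCases with
  | last => simpa using continuous_const
  | cast j =>
    simp only [Fin.snoc_castSucc]
    exact continuous_subtype_val.comp (continuous_apply j)

theorem continuous_shapeConfig : Continuous A.shapeConfig := by
  refine continuous_pi fun i => continuous_finsetSum _ fun j _ => ?_
  split_ifs
  · exact continuous_const.mul (continuous_coe_snoc j)
  · exact continuous_const

theorem contDiff_shapeConfig_torusExp :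
    ContDiff ℝ ∞ fun x : EuclideanSpace ℝ (Fin D) => A.shapeConfig (torusExp x) := by
  refine contDiff_pi.2 fun i => ContDiff.sum fun j _ => ?_
  split_ifs
  · refine contDiff_const.mul ?_
    induction j using Fin.lastCases with
    | last => simpa using contDiff_const
    | cast j => simpa only [Fin.snoc_castSucc] using contDiff_coe_torusExp j
  · exact contDiff_const

/-- A configuration is determined up to isometry by its shape. -/
theorem config_eq (z : A.configs) (i : Fin (D + 2)) :
    (z : Fin (D + 2) → ℂ) i =
      A.barDir z (Fin.last D) * A.shapeConfig (A.configShape z) i + z.1 0 := by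
  induction i using Fin.induction with
  | zero => rw [shapeConfig_zero]; ring
  | succ i ih =>
    have h1 := A.leg_mul_barDir z i
    have h2 := A.shapeConfig_succ (A.configShape z) i
    have h3 : A.barDir z (Fin.last D) *
        (Fin.snoc (fun k => (A.configShape z k : ℂ)) 1 : Fin (D + 1) → ℂ) i = A.barDir z i := by
      induction i using Fin.lastCases with
      | last => simp
      | cast i =>
        rw [Fin.snoc_castSucc, coe_configShape, relDir, mul_div_cancel₀ _ (A.barDir_ne_zero z.2 _)]
    linear_combination ih - h1 - A.barDir z (Fin.last D) * h2 - (A.leg i : ℂ) * h3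

theorem configShape_mem (z : A.configs) : ‖A.chainEnd (A.configShape z)‖ ∈ Icc A.lo A.hi := by
  have h1 := ((A.mem_configs_iff z).1 z.2).2
  rwa [A.config_eq z (Fin.last _), sub_add_cancel_right, norm_neg, norm_mul, A.norm_barDir z.2,
    one_mul, shapeConfig_last] at h1

theorem proj_eq_iff (z w : A.configs) : A.proj z = A.proj w ↔ A.configShape z = A.configShape w := by
  constructor
  · intro h
    obtain ⟨u, c, h⟩ := Quotient.exact h
    have h1 (i : Fin (D + 1)) : A.barDir w i = u * A.barDir z i := by
      rw [barDir, barDir, h, h, ← mul_div_assoc]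
      congr 1; ring
    funext j
    apply Circle.ext
    rw [coe_configShape, coe_configShape, relDir, relDir, h1, h1,
      mul_div_mul_left _ _ u.coe_ne_zero]
  · intro h
    -- The rotation is the quotient of the directions of the last fixed bars; the translation then
    -- matches the first vertices.
    let bd (z : A.configs) : Circle :=
      ⟨A.barDir z (Fin.last D), mem_sphere_zero_iff_norm.2 (A.norm_barDir z.2 _)⟩
    refine Quotient.sound ⟨bd w / bd z, w.1 0 - (bd w / bd z : Circle) * z.1 0, fun i => ?_⟩
    have h1 := A.config_eq z i
    have h2 := A.config_eq w i
    rw [← h] at h2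
    have h3 : ((bd w / bd z : Circle) : ℂ) * A.barDir z (Fin.last D) = A.barDir w (Fin.last D) := by
      rw [Circle.coe_div]
      exact div_mul_cancel₀ _ (A.barDir_ne_zero z.2 _)
    linear_combination h2 - ((bd w / bd z : Circle) : ℂ) * h1 -
      A.shapeConfig (A.configShape z) i * h3

/-- The shape of a point of the configuration space. -/
def shape : A.ModuliSpace → Fin D → Circle :=
  Quotient.lift A.configShape fun z w h => (A.proj_eq_iff z w).1 (Quotient.sound h)

@[simp]
theorem shape_proj (z : A.configs) : A.shape (A.proj z) = A.configShape z := rfl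

theorem proj_surjective : Function.Surjective A.proj := Quotient.mk_surjective

theorem continuous_proj : Continuous A.proj := continuous_quotient_mk'

theorem continuous_shape : Continuous A.shape := A.continuous_configShape.quotient_lift _

theorem shape_injective : Function.Injective A.shape := by
  intro p q h
  obtain ⟨z, rfl⟩ := A.proj_surjective p
  obtain ⟨w, rfl⟩ := A.proj_surjective q
  exact (A.proj_eq_iff z w).2 h

theorem shape_mem (p : A.ModuliSpace) : ‖A.chainEnd (A.shape p)‖ ∈ Icc A.lo A.hi := by
  obtain ⟨z, rfl⟩ := A.proj_surjective p
  exact A.configShape_mem z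

theorem range_shape : range A.shape = {u | ‖A.chainEnd u‖ ∈ Icc A.lo A.hi} := by
  ext u
  constructor
  · rintro ⟨p, rfl⟩
    exact A.shape_mem p
  · intro hu
    exact ⟨A.proj ⟨_, (A.shapeConfig_mem_iff u).2 hu⟩, A.configShape_shapeConfig _⟩

/-- The configuration space is homeomorphic to a subspace of the torus. -/
theorem isEmbedding_shape : IsEmbedding A.shape := by
  let e : A.ModuliSpace ≃ₜ {u | ‖A.chainEnd u‖ ∈ Icc A.lo A.hi} :=
    { toFun := fun p => ⟨A.shape p, A.shape_mem p⟩
      invFun := fun u => A.proj ⟨_, (A.shapeConfig_mem_iff u).2 u.2⟩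
      left_inv := fun p => A.shape_injective (A.configShape_shapeConfig _)
      right_inv := fun u => Subtype.ext (A.configShape_shapeConfig _)
      continuous_toFun := A.continuous_shape.subtype_mk _
      continuous_invFun := A.continuous_proj.comp
        ((A.continuous_shapeConfig.comp continuous_subtype_val).subtype_mk _) }
  exact IsEmbedding.subtypeVal.comp e.isEmbedding

theorem mem_liftedDomain_shape (x : EuclideanSpace ℝ (Fin D)) :
    x ∈ liftedDomain A.shape ↔ ‖A.chainEnd (torusExp x)‖ ∈ Icc A.lo A.hi := by
  rw [liftedDomain, mem_ofPred_eq, range_shape, mem_ofPred_eq]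

/-- Squaring makes the defining function smooth everywhere, also where the chain closes up. -/
theorem liftedDomain_shape : liftedDomain A.shape =
    (fun x => ‖A.chainEnd (torusExp x)‖ ^ 2) ⁻¹' Icc (A.lo ^ 2) (A.hi ^ 2) := by
  ext x
  rw [mem_liftedDomain_shape, mem_preimage, mem_Icc, mem_Icc,
    pow_le_pow_iff_left₀ A.lo_pos.le (norm_nonneg _) two_ne_zero,
    pow_le_pow_iff_left₀ (norm_nonneg _) (A.lo_pos.trans A.lo_lt_hi).le two_ne_zero]

variable {A}

/-- At a critical point the chain is straight and `r` is a signed sum of the legs. Moving `r` across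
with sign `-1` contradicts genericity. -/
theorem Generic.fderiv_ne_zero (hA : A.Generic) {r : ℝ} (hr : r = A.lo ∨ r = A.hi)
    {x : EuclideanSpace ℝ (Fin D)} (hx : ‖A.chainEnd (torusExp x)‖ ^ 2 = r ^ 2) :
    fderiv ℝ (fun x => ‖A.chainEnd (torusExp x)‖ ^ 2) x ≠ 0 := by
  intro h0
  have hr0 : 0 < r := by
    rcases hr with rfl | rfl
    exacts [A.lo_pos, A.lo_pos.trans A.lo_lt_hi]
  have hx' : ‖A.chainEnd (torusExp x)‖ = r := (pow_left_inj₀ (norm_nonneg _) hr0.le two_ne_zero).1 hx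
  have hne : A.chainEnd (torusExp x) ≠ 0 := norm_ne_zero_iff.1 (by rw [hx']; exact hr0.ne')
  obtain ⟨ε, ε', hε, hε', hsum⟩ := exists_signs_of_critical _ (A.leg_pos (Fin.last D)).ne' x hne
    (fun j => by
      change fderiv ℝ (fun x => ‖A.chainEnd (torusExp x)‖ ^ 2) x _ = 0
      rw [h0]; rfl)
  change _ = ‖A.chainEnd (torusExp x)‖ at hsum
  rw [hx'] at hsum
  let δ : Fin (D + 2) → ℝ := Fin.snoc (Fin.snoc ε ε' : Fin (D + 1) → ℝ) (-1)
  have hδ : IsSign δ := by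
    intro j
    induction j using Fin.lastCases with
    | last => right; simp [δ]
    | cast j =>
      induction j using Fin.lastCases with
      | last => simpa [δ] using hε'
      | cast j => simpa [δ] using hε j
  have h1 := hA δ hδ
  simp only [lower, upper, Fin.sum_univ_castSucc, Fin.snoc_castSucc, Fin.snoc_last, δ, hsum] at h1
  rcases hr with rfl | rfl
  · exact h1.1 (by ring)
  · exact h1.2 (by ring)

/-- The smooth structure of a generic configuration space, given by the shape. -/
theorem Generic.exists_smoothStructure (hA : A.Generic) : ∃ S : SmoothStructure A,
    IsToral (boundaryModel D) (M := S.Carrier) A.shape := by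
  have hsm : ContDiff ℝ ∞ fun x : EuclideanSpace ℝ (Fin D) => ‖A.chainEnd (torusExp x)‖ ^ 2 :=
    (contDiff_armEnd _ _).norm_sq ℝ
  obtain ⟨cs, hman, htor⟩ := exists_toral_chartedSpace (boundaryModel D) A.isEmbedding_shape
    (fun x hx => by
      rw [liftedDomain_shape] at hx ⊢
      refine exists_straightening hsm
        (pow_lt_pow_left₀ A.lo_lt_hi A.lo_pos.le two_ne_zero) (fun y hy => ?_) hx
      rcases hy with hy | hy
      · exact hA.fderiv_ne_zero (.inl rfl) hy
      · exact hA.fderiv_ne_zero (.inr rfl) hy)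
  refine ⟨⟨cs, hman, fun f => ⟨fun hf => ?_, ?_⟩⟩, htor⟩
  · classical
    let g : (Fin (D + 2) → ℂ) → ℝ := fun z => if hz : z ∈ A.configs then f (A.proj ⟨z, hz⟩) else 0
    have hg (z : A.configs) : g z = f (A.proj z) := dif_pos z.2
    refine ⟨g, fun z hz => ?_, hg⟩
    have hne : Nonempty A.ModuliSpace := ⟨A.proj ⟨z, hz⟩⟩
    let F : EuclideanSpace ℝ (Fin D) → ℝ := fun x => f (Function.invFun A.shape (torusExp x))
    have hF : ContDiffOn ℝ ∞ F (liftedDomain A.shape) := contMDiffOn_iff_contDiffOn.1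
      (hf.comp_contMDiffOn (htor.2 _ fun x hx => apply_invFun_torusExp hx))
    obtain ⟨a, ha⟩ := torusExp_surjective (A.configShape ⟨z, hz⟩)
    -- The same formula as for the angles of the shape, but defined on all of `ℂⁿ`, so that its
    -- differentiability at `z` makes sense.
    let ang : (Fin (D + 2) → ℂ) → EuclideanSpace ℝ (Fin D) := fun w =>
      WithLp.toLp 2 fun j => a j + Complex.arg (A.relDir w j * ((Circle.exp (a j))⁻¹ : Circle))
    have hang (w : A.configs) : ang w = angles a (A.configShape w) := rfl
    have hmaps : MapsTo ang A.configs (liftedDomain A.shape) := fun w hw =>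
      angles_mem_liftedDomain (R := A.shape) a (A.proj ⟨w, hw⟩)
    have hangd : ContDiffAt ℝ ∞ ang z := by
      refine (contDiffAt_piLp 2).2 fun j => contDiffAt_const.add ?_
      refine (contDiffAt_arg ?_).comp z ((A.contDiffAt_relDir hz j).mul contDiffAt_const)
      have h1 := torusExp_mem_branchDomain_self a j
      rw [ha] at h1
      exact h1
    refine ((hF _ (hmaps hz)).comp z hangd.contDiffWithinAt hmaps).congr (fun w hw => ?_) ?_
    · rw [hg ⟨w, hw⟩]
      change _ = f (Function.invFun A.shape (torusExp (ang (⟨w, hw⟩ : A.configs))))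
      rw [hang, torusExp_angles]
      exact congrArg f (Function.leftInverse_invFun A.shape_injective _).symm
    · rw [hg ⟨z, hz⟩]
      change _ = f (Function.invFun A.shape (torusExp (ang (⟨z, hz⟩ : A.configs))))
      rw [hang, torusExp_angles]
      exact congrArg f (Function.leftInverse_invFun A.shape_injective _).symm
  · rintro ⟨g, hg, hgf⟩
    -- Conversely, the normalised configurations form a smooth section, along which `g` computes
    -- `f`.
    refine htor.contMDiff_of_eq (F := fun x => g (A.shapeConfig (torusExp x))) ?_ ?_
    · refine contMDiffOn_iff_contDiffOn.2 (hg.comp A.contDiff_shapeConfig_torusExp.contDiffOn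
        fun x hx => (A.shapeConfig_mem_iff _).2 ((A.mem_liftedDomain_shape x).1 hx))
    · intro p x hpx
      have h1 : A.shapeConfig (torusExp x) ∈ A.configs :=
        (A.shapeConfig_mem_iff _).2 (hpx ▸ A.shape_mem p)
      rw [hgf ⟨_, h1⟩]
      congr 1
      apply A.shape_injective
      rw [hpx, shape_proj, configShape_shapeConfig]

end MetricData

/-! ### Isotopy of regular domains in the torus -/

section Isotopy

variable {m : ℕ}

/-- The deck transformations of the universal covering of the torus. -/
def latticeVector (k : Fin m → ℤ) : EuclideanSpace ℝ (Fin m) :=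
  WithLp.toLp 2 fun j => k j * (2 * Real.pi)

theorem torusExp_eq_iff {x y : EuclideanSpace ℝ (Fin m)} :
    torusExp x = torusExp y ↔ ∃ k, x = y + latticeVector k := by
  constructor
  · intro h
    choose k hk using fun j => Circle.exp_eq_exp.1 (congrFun h j)
    exact ⟨k, by ext j; simp [latticeVector, hk j]⟩
  · rintro ⟨k, rfl⟩
    funext j
    exact Circle.exp_eq_exp.2 ⟨k j, by simp [latticeVector]⟩

/-- A compact set of representatives for `ℝ / 2ℤ` times the torus. -/
theorem exists_compact_representatives : ∃ K : Set (ℝ × EuclideanSpace ℝ (Fin m)), IsCompact K ∧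
    ∀ v, ∃ (k : ℤ) (l : Fin m → ℤ), v + ((2 * k : ℝ), latticeVector l) ∈ K := by
  let e := (EuclideanSpace.equiv (Fin m) ℝ).symm
  refine ⟨Icc 0 2 ×ˢ (e '' (Set.pi univ fun _ => Icc 0 (2 * Real.pi))),
    isCompact_Icc.prod ((isCompact_univ_pi fun _ => isCompact_Icc).image e.continuous),
    fun v => ⟨-⌊v.1 / 2⌋, fun j => -⌊v.2 j / (2 * Real.pi)⌋, ?_, ?_⟩⟩
  · have h1 := Int.floor_le (v.1 / 2)
    have h2 := Int.lt_floor_add_one (v.1 / 2)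
    simp only [Prod.fst_add, Int.cast_neg, mem_Icc]
    constructor <;> linarith
  · refine ⟨_, fun j _ => ?_, (e.apply_symm_apply _)⟩
    have hp : 0 < 2 * Real.pi := Real.two_pi_pos
    have h1 := (le_div_iff₀ hp).1 (Int.floor_le (v.2 j / (2 * Real.pi)))
    have h2 := (div_lt_iff₀ hp).1 (Int.lt_floor_add_one (v.2 j / (2 * Real.pi)))
    change v.2 j + ((-⌊v.2 j / (2 * Real.pi)⌋ : ℤ) : ℝ) * (2 * Real.pi) ∈ _
    rw [Int.cast_neg, mem_Icc]
    constructor <;> linarith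

theorem fderiv_eq_of_add_period {V W : Type*} [NormedAddCommGroup V] [NormedSpace ℝ V]
    [NormedAddCommGroup W] [NormedSpace ℝ W] {f : V → W} {p : V} (h : ∀ v, f (v + p) = f v)
    (v : V) : fderiv ℝ f (v + p) = fderiv ℝ f v := by
  rw [← fderiv_comp_add_right]
  simp only [h]

/-- The derivative is periodic too, hence bounded by its maximum over a compact set of
representatives. -/
theorem exists_lipschitzWith_of_periodic
    {f : ℝ × EuclideanSpace ℝ (Fin m) → ℝ × EuclideanSpace ℝ (Fin m)} (hf : ContDiff ℝ ∞ f)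
    (hper : ∀ (k : ℤ) (l : Fin m → ℤ) v, f (v + ((2 * k : ℝ), latticeVector l)) = f v) :
    ∃ c, LipschitzWith c f := by
  obtain ⟨K, hK, hrep⟩ := exists_compact_representatives (m := m)
  obtain ⟨C, hC⟩ := hK.exists_bound_of_continuousOn (hf.continuous_fderiv (by simp)).continuousOn
  refine ⟨C.toNNReal, lipschitzWith_of_nnnorm_fderiv_le (hf.differentiable (by simp)) fun v => ?_⟩
  obtain ⟨k, l, hkl⟩ := hrep v
  have := hC _ hkl
  rw [fderiv_eq_of_add_period (hper k l)] at this
  rw [← NNReal.coe_le_coe, coe_nnnorm]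
  exact this.trans (Real.le_coe_toNNReal C)

/-- A periodic family of functions on the torus without critical points on the levels `a` and `b`
has, up to a diffeomorphism of the torus, a constant preimage of `[a, b]`. -/
theorem exists_isotopy {h : ℝ × EuclideanSpace ℝ (Fin m) → ℝ} (hh : ContDiff ℝ ∞ h)
    (hper : ∀ (k : ℤ) (l : Fin m → ℤ) v, h (v + ((2 * k : ℝ), latticeVector l)) = h v) {a b : ℝ}
    (hreg : ∀ v, h v = a ∨ h v = b → ∃ j, fderiv ℝ h v (0, EuclideanSpace.single j 1) ≠ 0) :
    ∃ φ : EuclideanSpace ℝ (Fin m) ≃ EuclideanSpace ℝ (Fin m),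
      ContDiff ℝ ∞ φ ∧ ContDiff ℝ ∞ φ.symm ∧
      (∀ x y, torusExp (φ x) = torusExp (φ y) ↔ torusExp x = torusExp y) ∧
      ∀ x, h (1, φ x) ∈ Icc a b ↔ h (0, x) ∈ Icc a b := by
  let dt (v) : ℝ := fderiv ℝ h v (1, 0)
  let dx (j : Fin m) (v) : ℝ := fderiv ℝ h v (0, EuclideanSpace.single j 1)
  have hdh : ContDiff ℝ ∞ (fderiv ℝ h) := hh.fderiv_right (by simp)
  have hdt : ContDiff ℝ ∞ dt := hdh.clm_apply contDiff_const
  have hdx (j) : ContDiff ℝ ∞ (dx j) := hdh.clm_apply contDiff_const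
  -- The squared spatial gradient may vanish off the two levels; the second summand is positive
  -- exactly there, so that `q` never vanishes.
  let q (v) : ℝ := ∑ j, dx j v ^ 2 + ((h v - a) * (h v - b)) ^ 2
  have hq : ContDiff ℝ ∞ q := (ContDiff.sum fun j _ => (hdx j).pow 2).add
    (((hh.sub contDiff_const).mul (hh.sub contDiff_const)).pow 2)
  have hq0 (v) : q v ≠ 0 := by
    intro h0
    have h1 : 0 ≤ ∑ j, dx j v ^ 2 := Finset.sum_nonneg fun j _ => sq_nonneg _
    have h2 : ((h v - a) * (h v - b)) ^ 2 = 0 :=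
      le_antisymm (by simp only [q] at h0; linarith) (sq_nonneg _)
    have h3 : ∑ j, dx j v ^ 2 = 0 := by simp only [q] at h0; linarith
    obtain ⟨j, hj⟩ := hreg v (by
      rcases mul_eq_zero.1 ((pow_eq_zero_iff two_ne_zero).1 h2) with h4 | h4
      · exact .inl (sub_eq_zero.1 h4)
      · exact .inr (sub_eq_zero.1 h4))
    have h5 := (Finset.sum_eq_zero_iff_of_nonneg fun j _ => sq_nonneg (dx j v)).1 h3 j
      (Finset.mem_univ j)
    exact hj ((pow_eq_zero_iff two_ne_zero).1 h5)
  -- Unit speed in time, corrected along the spatial gradient. With `q` in the denominator the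
  -- derivative of `h` along `f` is not zero everywhere, but it is divisible by both `h - a` and `h
  -- - b`, which suffices to keep their signs.
  let f (v : ℝ × EuclideanSpace ℝ (Fin m)) : ℝ × EuclideanSpace ℝ (Fin m) :=
    (1, WithLp.toLp 2 fun j => -(dt v / q v) * dx j v)
  have hf : ContDiff ℝ ∞ f := contDiff_const.prodMk
    ((contDiff_piLp 2).2 fun j => (hdt.div hq hq0).neg.mul (hdx j))
  have hfper (k : ℤ) (l : Fin m → ℤ) (v) : f (v + ((2 * k : ℝ), latticeVector l)) = f v := by
    simp only [f, dt, dx, q, fderiv_eq_of_add_period (hper k l), hper k l]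
  obtain ⟨c, hL⟩ := exists_lipschitzWith_of_periodic hf hfper
  obtain ⟨Φ, hΦ, hΦ', hΦper, hΦlin, hΦsign⟩ := exists_flow_equiv hf hL
  have hder (v) : fderiv ℝ h v (f v) = dt v / q v * ((h v - a) * (h v - b)) ^ 2 := by
    have h1 : f v = (1, (0 : EuclideanSpace ℝ (Fin m))) +
        ∑ j, (-(dt v / q v) * dx j v) • ((0 : ℝ), EuclideanSpace.single j (1 : ℝ)) := by
      refine Prod.ext ?_ ?_
      · simp [f, Prod.fst_sum]
      · ext i
        simp [f, Prod.snd_sum, Finset.sum_apply, Pi.single_apply]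
    have h2 : fderiv ℝ h v (f v) = dt v + ∑ j, (-(dt v / q v) * dx j v) * dx j v := by
      rw [h1, map_add, map_sum]
      simp only [map_smul, smul_eq_mul, dt, dx]
    have h3 : ∑ j, (-(dt v / q v) * dx j v) * dx j v = -(dt v / q v) * ∑ j, dx j v ^ 2 := by
      rw [Finset.mul_sum]
      exact Finset.sum_congr rfl fun j _ => by ring
    have h4 : dt v = dt v / q v * (∑ j, dx j v ^ 2 + ((h v - a) * (h v - b)) ^ 2) :=
      (div_mul_cancel₀ _ (hq0 v)).symm
    rw [h2, h3]
    linear_combination h4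
  have hsign (v) : h (Φ v) ∈ Icc a b ↔ h v ∈ Icc a b := by
    have h1 := hΦsign (fun v => h v - a) (fun v => dt v / q v * ((h v - a) * (h v - b) ^ 2))
      (hh.sub contDiff_const)
      ((hdt.div hq hq0).mul ((hh.sub contDiff_const).mul
        ((hh.sub contDiff_const).pow 2))).continuous
      (fun v => by rw [fderiv_sub_const, hder]; ring) v
    have h2 := hΦsign (fun v => b - h v) (fun v => dt v / q v * ((h v - a) ^ 2 * (h v - b)))
      (contDiff_const.sub hh)
      ((hdt.div hq hq0).mul (((hh.sub contDiff_const).pow 2).mul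
        (hh.sub contDiff_const))).continuous
      (fun v => by rw [fderiv_const_sub, neg_apply, hder]; ring) v
    rw [mem_Icc, mem_Icc, ← sub_nonneg, h1, sub_nonneg, ← sub_nonneg (a := b), h2, sub_nonneg]
  -- The flow takes the slice at time `0` to the slice at time `1`, which defines `φ`.
  have hfst (v) : (Φ v).1 = v.1 + 1 := hΦlin (ContinuousLinearMap.fst ℝ ℝ _) 1 (fun v => rfl) v
  have hfst' (v) : (Φ.symm v).1 = v.1 - 1 := by
    have := hfst (Φ.symm v)
    rw [Φ.apply_symm_apply] at this
    linarith
  have h01 (x) : Φ (0, x) = (1, (Φ (0, x)).2) := Prod.ext (by simp [hfst]) rfl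
  have h10 (x) : Φ.symm (1, x) = (0, (Φ.symm (1, x)).2) := Prod.ext (by simp [hfst']) rfl
  let φ : EuclideanSpace ℝ (Fin m) ≃ EuclideanSpace ℝ (Fin m) :=
    { toFun := fun x => (Φ (0, x)).2
      invFun := fun x => (Φ.symm (1, x)).2
      left_inv := fun x => by simp only [← h01, Φ.symm_apply_apply]
      right_inv := fun x => by simp only [← h10, Φ.apply_symm_apply] }
  have hφper (x) (l : Fin m → ℤ) : φ (x + latticeVector l) = φ x + latticeVector l := by
    have h1 := hΦper ((0 : ℝ), latticeVector l) (fun v => by simpa using hfper 0 l v) (0, x)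
    rw [Prod.mk_add_mk, add_zero] at h1
    change (Φ (0, x + latticeVector l)).2 = _
    rw [h1]; rfl
  refine ⟨φ, contDiff_snd.comp (hΦ.comp (contDiff_const.prodMk contDiff_id)),
    contDiff_snd.comp (hΦ'.comp (contDiff_const.prodMk contDiff_id)), fun x y => ?_, fun x => ?_⟩
  · rw [torusExp_eq_iff, torusExp_eq_iff]
    refine exists_congr fun l => ?_
    rw [← hφper, φ.apply_eq_iff_eq]
  · rw [← hsign (0, x), h01]; rfl

end Isotopy

/-! ### Shrinking the first bar -/

namespace MetricData

variable {d : ℕ} (A : MetricData (d + 1))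

/-- The lengths of the fixed bars but the last, with the first one replaced by `t`. -/
def shrunkLegs (t : ℝ) : Fin (d + 1) → ℝ := Fin.cons t fun j => A.leg j.succ.castSucc

theorem armEnd_shrunkLegs (t b : ℝ) (u : Fin (d + 1) → Circle) :
    armEnd (A.shrunkLegs t) b u =
      (t : ℂ) * u 0 + (∑ j : Fin d, (A.leg j.succ.castSucc : ℂ) * u j.succ + b) := by
  simp [armEnd, shrunkLegs, Fin.sum_univ_succ, add_assoc]

/-- The direction `u 0` drops out: this is the source of the circle factor. -/
theorem armEnd_shrunkLegs_zero (u : Fin (d + 1) → Circle) :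
    armEnd (A.shrunkLegs 0) (A.leg (Fin.last _)) u = A.dropFirst.chainEnd (Fin.tail u) := by
  rw [armEnd_shrunkLegs, Complex.ofReal_zero, zero_mul, zero_add]
  rfl

theorem armEnd_shrunkLegs_leg (u : Fin (d + 1) → Circle) :
    armEnd (A.shrunkLegs (A.leg 0)) (A.leg (Fin.last _)) u = A.chainEnd u := by
  rw [armEnd_shrunkLegs]
  simp only [chainEnd, armEnd, Fin.sum_univ_succ, add_assoc]
  rfl

variable {A}

/-- If all partial derivatives vanish the arm is straight, so the signed sum of the remaining legs
differs from `r` by `±t`, contrary to `hr` and `t ≤ ℓ₁`. -/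
theorem exists_fderiv_shrunk_ne_zero {r : ℝ} (hr0 : 0 < r)
    (hr : ∀ ε : Fin (d + 1) → ℝ, IsSign ε →
      A.leg 0 < |∑ j, ε j * A.dropFirst.leg j - r|) {t : ℝ} (ht : t ∈ Icc 0 (A.leg 0))
    {x : EuclideanSpace ℝ (Fin (d + 1))}
    (hx : ‖armEnd (A.shrunkLegs t) (A.leg (Fin.last _)) (torusExp x)‖ ^ 2 = r ^ 2) :
    ∃ j, fderiv ℝ (fun x => ‖armEnd (A.shrunkLegs t) (A.leg (Fin.last _)) (torusExp x)‖ ^ 2) x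
      (EuclideanSpace.single j 1) ≠ 0 := by
  by_contra! hcon
  have hx' := (pow_left_inj₀ (norm_nonneg _) hr0.le two_ne_zero).1 hx
  obtain ⟨ε, ε', hε, hε', hsum⟩ := exists_signs_of_critical _ (A.leg_pos (Fin.last _)).ne' x
    (norm_ne_zero_iff.1 (by rw [hx']; exact hr0.ne')) hcon
  rw [hx'] at hsum
  have h1 := hr (Fin.snoc (fun j => ε j.succ) ε') fun j => by
    induction j using Fin.lastCases with
    | last => simpa using hε'
    | cast j => simpa using hε j.succ
  have h2 : ∑ j, (Fin.snoc (fun j => ε j.succ) ε' : Fin (d + 1) → ℝ) j * A.dropFirst.leg j - r =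
      -(ε 0 * t) := by
    rw [Fin.sum_univ_castSucc]
    simp only [Fin.snoc_castSucc, Fin.snoc_last]
    rw [Fin.sum_univ_succ] at hsum
    simp only [shrunkLegs, Fin.cons_zero, Fin.cons_succ] at hsum
    rw [← hsum]
    change _ + _ * A.leg (Fin.last _) - _ = _
    have h3 : ∑ j : Fin d, ε j.succ * A.dropFirst.leg j.castSucc =
      ∑ j : Fin d, ε j.succ * A.leg j.succ.castSucc := rfl
    rw [h3]; ring
  have h3 : |ε 0| = 1 := by rcases hε 0 with h | h <;> simp [h]
  rw [h2, abs_neg, abs_mul, h3, one_mul, abs_of_nonneg ht.1] at h1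
  exact h1.not_ge ht.2

/-- Genericity excludes the value zero, and a negative sum becomes positive when all signs are
reversed. -/
theorem leg_lt_abs_of_small {s : Fin (d + 2) → ℝ} {r : ℝ} (hs : s = Fin.snoc A.dropFirst.leg r)
    (hgen : ∀ ε : Fin (d + 2) → ℝ, IsSign ε → ∑ j, ε j * s j ≠ 0)
    (hsmall : ∀ ε : Fin (d + 2) → ℝ, IsSign ε →
      0 < ∑ j, ε j * s j → A.leg 0 < ∑ j, ε j * s j)
    (ε : Fin (d + 1) → ℝ) (hε : IsSign ε) : A.leg 0 < |∑ j, ε j * A.dropFirst.leg j - r| := by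
  have hsum : ∑ j, ε j * A.dropFirst.leg j - r =
      ∑ j, (Fin.snoc ε (-1) : Fin (d + 2) → ℝ) j * s j := by
    rw [hs, Fin.sum_univ_castSucc (n := d + 1)]
    simp [sub_eq_add_neg]
  have hδ : IsSign (Fin.snoc ε (-1) : Fin (d + 2) → ℝ) := fun j => by
    induction j using Fin.lastCases with
    | last => simp
    | cast j => simpa using hε j
  rw [hsum]
  rcases lt_or_gt_of_ne (hgen _ hδ) with h | h
  · have h1 := hsmall (-(Fin.snoc ε (-1) : Fin (d + 2) → ℝ)) fun j => by
      rcases hδ j with h2 | h2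
      · right; rw [Pi.neg_apply, h2]
      · left; rw [Pi.neg_apply, h2, neg_neg]
    simp only [Pi.neg_apply, neg_mul, Finset.sum_neg_distrib] at h1
    rw [abs_of_neg h]
    exact h1 (by linarith)
  · rw [abs_of_pos h]
    exact hsmall _ hδ h

/-- If the first bar is short, the linkage is isotopic to the one in which its length is zero. -/
theorem exists_shape_equiv (hA' : A.dropFirst.Generic)
    (hsmall : ∀ ε : Fin (d + 2) → ℝ, IsSign ε →
      (0 < ∑ j, ε j * A.dropFirst.lower j → A.leg 0 < ∑ j, ε j * A.dropFirst.lower j) ∧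
      (0 < ∑ j, ε j * A.dropFirst.upper j → A.leg 0 < ∑ j, ε j * A.dropFirst.upper j)) :
    ∃ φ : EuclideanSpace ℝ (Fin (d + 1)) ≃ EuclideanSpace ℝ (Fin (d + 1)),
      ContDiff ℝ ∞ φ ∧ ContDiff ℝ ∞ φ.symm ∧
      (∀ x y, torusExp (φ x) = torusExp (φ y) ↔ torusExp x = torusExp y) ∧
      ∀ x, φ x ∈ liftedDomain A.shape ↔
        ‖A.dropFirst.chainEnd (Fin.tail (torusExp x))‖ ∈ Icc A.lo A.hi := by
  -- A smooth function of period `2` with `τ 0 = 0` and `τ 1 = ℓ₁` that never leaves `[0, ℓ₁]`: the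
  -- family is periodic in time, and its levels are regular at all times.
  let τ (s : ℝ) : ℝ := A.leg 0 * ((1 - Real.cos (s * Real.pi)) / 2)
  have hτ : ContDiff ℝ ∞ τ := by simp only [τ]; fun_prop
  have hτmem (s) : τ s ∈ Icc 0 (A.leg 0) := by
    have h1 := Real.neg_one_le_cos (s * Real.pi)
    have h2 := Real.cos_le_one (s * Real.pi)
    exact ⟨mul_nonneg (A.leg_pos 0).le (by linarith),
      mul_le_of_le_one_right (A.leg_pos 0).le (by linarith)⟩
  let h (v : ℝ × EuclideanSpace ℝ (Fin (d + 1))) : ℝ :=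
    ‖armEnd (A.shrunkLegs (τ v.1)) (A.leg (Fin.last _)) (torusExp v.2)‖ ^ 2
  have hcoe (j) : ContDiff ℝ ∞ fun v : ℝ × EuclideanSpace ℝ (Fin (d + 1)) =>
      (torusExp v.2 j : ℂ) := (contDiff_coe_torusExp j).comp contDiff_snd
  have hh : ContDiff ℝ ∞ h := by
    refine ContDiff.norm_sq ℝ ?_
    simp only [armEnd_shrunkLegs]
    exact ((Complex.ofRealCLM.contDiff.comp (hτ.comp contDiff_fst)).mul (hcoe 0)).add
      ((ContDiff.sum fun j _ => contDiff_const.mul (hcoe _)).add contDiff_const)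
  have hper (k : ℤ) (l : Fin (d + 1) → ℤ) (v) : h (v + ((2 * k : ℝ), latticeVector l)) = h v := by
    have h1 : τ (v.1 + 2 * k) = τ v.1 := by
      simp only [τ]
      rw [show (v.1 + 2 * k) * Real.pi = v.1 * Real.pi + k * (2 * Real.pi) by ring,
        Real.cos_add_int_mul_two_pi]
    have h2 : torusExp (v.2 + latticeVector l) = torusExp v.2 := torusExp_eq_iff.2 ⟨l, rfl⟩
    simp only [h, Prod.fst_add, Prod.snd_add, h1, h2]
  have hpartial (v : ℝ × EuclideanSpace ℝ (Fin (d + 1))) (w) :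
      fderiv ℝ h v (0, w) = fderiv ℝ (fun x => ‖armEnd (A.shrunkLegs (τ v.1)) (A.leg (Fin.last _)) (torusExp x)‖ ^ 2) v.2 w := by
    have h1 : HasFDerivAt (fun x => h (v.1, x))
        ((fderiv ℝ h v).comp (ContinuousLinearMap.inr ℝ ℝ _)) v.2 :=
      HasFDerivAt.comp (g := h) (f := fun x => (v.1, x)) v.2
        (hh.differentiable (by simp) v).hasFDerivAt (hasFDerivAt_prodMk_right v.1 v.2)
    rw [h1.fderiv]; rfl
  have hreg (v) (hv : h v = A.lo ^ 2 ∨ h v = A.hi ^ 2) :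
      ∃ j, fderiv ℝ h v (0, EuclideanSpace.single j 1) ≠ 0 := by
    simp only [hpartial]
    rcases hv with hv | hv
    · exact exists_fderiv_shrunk_ne_zero A.lo_pos (leg_lt_abs_of_small (s := A.dropFirst.lower) rfl
        (fun ε hε => (hA' ε hε).1) fun ε hε => (hsmall ε hε).1) (hτmem v.1) hv
    · exact exists_fderiv_shrunk_ne_zero (A.lo_pos.trans A.lo_lt_hi)
        (leg_lt_abs_of_small (s := A.dropFirst.upper) rfl
        (fun ε hε => (hA' ε hε).2) fun ε hε => (hsmall ε hε).2) (hτmem v.1) hv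
  obtain ⟨φ, hφ, hφ', hφt, hφm⟩ := exists_isotopy hh hper hreg
  refine ⟨φ, hφ, hφ', hφt, fun x => ?_⟩
  have hτ0 : τ 0 = 0 := by simp [τ]
  have hτ1 : τ 1 = A.leg 0 := by simp only [τ]; rw [one_mul, Real.cos_pi]; ring
  have h1 := hφm x
  simp only [h, hτ0, hτ1, armEnd_shrunkLegs_zero, armEnd_shrunkLegs_leg] at h1
  rw [liftedDomain_shape]
  refine h1.trans ?_
  rw [mem_Icc, mem_Icc, pow_le_pow_iff_left₀ A.lo_pos.le (norm_nonneg _) two_ne_zero,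
    pow_le_pow_iff_left₀ (norm_nonneg _) (A.lo_pos.trans A.lo_lt_hi).le two_ne_zero]

end MetricData

/-! ### Splitting off the circle and descending to the quotients -/

theorem contMDiffAt_circleArg {t : ℝ} {w : Circle} (hw : Circle.exp t = w) :
    ContMDiffAt (𝓡 1) 𝓘(ℝ, ℝ) ∞
      (fun w : Circle => t + Complex.arg ((w : ℂ) * ((Circle.exp t)⁻¹ : Circle))) w := by
  subst hw
  have hcoe : ContMDiff (𝓡 1) 𝓘(ℝ, ℂ) ∞ (fun w : Circle => (w : ℂ)) :=
    haveI := finrank_real_complex_fact'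
    contMDiff_coe_sphere
  have h1 : ContDiffAt ℝ ∞ (fun z : ℂ => t + Complex.arg (z * ((Circle.exp t)⁻¹ : Circle)))
      (Circle.exp t : ℂ) := by
    refine contDiffAt_const.add ((contDiffAt_arg ?_).comp _ (contDiffAt_id.mul contDiffAt_const))
    have h : (Circle.exp t : ℂ) * ((Circle.exp t)⁻¹ : Circle) = 1 := by
      rw [← Circle.coe_mul, mul_inv_cancel, Circle.coe_one]
    change (Circle.exp t : ℂ) * ((Circle.exp t)⁻¹ : Circle) ∈ _
    rw [h]
    exact Complex.one_mem_slitPlane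
  exact h1.contMDiffAt.comp (Circle.exp t) hcoe.contMDiffAt

section Coordinates

variable {d : ℕ}

/-- Prepending a coordinate. -/
def consCoord (v : ℝ × EuclideanSpace ℝ (Fin d)) : EuclideanSpace ℝ (Fin (d + 1)) :=
  WithLp.toLp 2 (Fin.cons v.1 v.2 : Fin (d + 1) → ℝ)

/-- Forgetting the first coordinate. -/
def tailCoord (x : EuclideanSpace ℝ (Fin (d + 1))) : EuclideanSpace ℝ (Fin d) :=
  WithLp.toLp 2 fun j => x j.succ

theorem contDiff_consCoord : ContDiff ℝ ∞ (consCoord (d := d)) := by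
  refine (contDiff_piLp 2).2 fun j => ?_
  cases j using Fin.cases with
  | zero => exact contDiff_fst
  | succ j =>
    have : ContDiff ℝ ∞ fun v : ℝ × EuclideanSpace ℝ (Fin d) => v.2 j := by fun_prop
    exact this

theorem contDiff_tailCoord : ContDiff ℝ ∞ (tailCoord (d := d)) := by
  refine (contDiff_piLp 2).2 fun j => ?_
  have : ContDiff ℝ ∞ fun x : EuclideanSpace ℝ (Fin (d + 1)) => x j.succ := by fun_prop
  exact this

theorem torusExp_tailCoord (x : EuclideanSpace ℝ (Fin (d + 1))) :
    torusExp (tailCoord x) = Fin.tail (torusExp x) := rfl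

theorem torusExp_consCoord (t : ℝ) (y : EuclideanSpace ℝ (Fin d)) :
    torusExp (consCoord (t, y)) = Fin.cons (Circle.exp t) (torusExp y) := by
  funext j
  cases j using Fin.cases with
  | zero => rfl
  | succ j => rfl

theorem torusExp_eq_cons (x : EuclideanSpace ℝ (Fin (d + 1))) :
    torusExp x = Fin.cons (Circle.exp (x 0)) (torusExp (tailCoord x)) := by
  rw [torusExp_tailCoord]
  exact (Fin.cons_self_tail (torusExp x)).symm

end Coordinates

/-- A diffeomorphism of tori that carries the product of a circle and a domain to a domain. -/
theorem nonempty_diffeomorph_of_torus_equiv {d : ℕ} {H H' M M' : Type*} [TopologicalSpace H]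
    [TopologicalSpace H'] [TopologicalSpace M] [TopologicalSpace M'] [ChartedSpace H M]
    [ChartedSpace H' M'] {I : ModelWithCorners ℝ (EuclideanSpace ℝ (Fin (d + 1))) H}
    {I' : ModelWithCorners ℝ (EuclideanSpace ℝ (Fin d)) H'}
    {R : M → Fin (d + 1) → Circle} {R' : M' → Fin d → Circle}
    (hR : IsToral I R) (hR' : IsToral I' R') (hinj : Function.Injective R)
    (hinj' : Function.Injective R')
    (φ : EuclideanSpace ℝ (Fin (d + 1)) ≃ EuclideanSpace ℝ (Fin (d + 1)))
    (hφ : ContDiff ℝ ∞ φ) (hφ' : ContDiff ℝ ∞ φ.symm)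
    (hφt : ∀ x y, torusExp (φ x) = torusExp (φ y) ↔ torusExp x = torusExp y)
    (hφm : ∀ x, φ x ∈ liftedDomain R ↔ tailCoord x ∈ liftedDomain R') :
    Nonempty (Diffeomorph I (I'.prod (𝓡 1)) M (M' × Circle) ∞) := by
  have hφt' (x y) : torusExp (φ.symm x) = torusExp (φ.symm y) ↔ torusExp x = torusExp y := by
    rw [← hφt, φ.apply_symm_apply, φ.apply_symm_apply]
  have hφm' (x) : tailCoord (φ.symm x) ∈ liftedDomain R' ↔ x ∈ liftedDomain R := by
    rw [← hφm, φ.apply_symm_apply]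
  rcases isEmpty_or_nonempty M with hM | hM
  · have hM' : IsEmpty M' := ⟨fun q => by
      have h1 := (hφm (consCoord (0, angles 0 (R' q)))).2
        (angles_mem_liftedDomain (R := R') 0 q)
      exact hM.elim h1.choose⟩
    exact ⟨⟨Equiv.equivOfIsEmpty _ _, fun p => hM.elim p, fun q => hM'.elim q.1⟩⟩
  have hM' : Nonempty M' := hM.elim fun p =>
    ⟨((hφm' (angles 0 (R p))).2 (angles_mem_liftedDomain (R := R) 0 p)).choose⟩
  let P : EuclideanSpace ℝ (Fin (d + 1)) → M := fun x => Function.invFun R (torusExp x)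
  let P' : EuclideanSpace ℝ (Fin d) → M' := fun x => Function.invFun R' (torusExp x)
  have hP (x) (hx : x ∈ liftedDomain R) : R (P x) = torusExp x := apply_invFun_torusExp hx
  have hP' (x) (hx : x ∈ liftedDomain R') : R' (P' x) = torusExp x := apply_invFun_torusExp hx
  have hPR (p a) : P (angles a (R p)) = p := hinj (by
    rw [hP _ (angles_mem_liftedDomain a p), torusExp_angles])
  have hPc {x y} (h : torusExp x = torusExp y) : P x = P y := congrArg (Function.invFun R) h
  have hPc' {x y} (h : torusExp x = torusExp y) : P' x = P' y := congrArg (Function.invFun R') h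
  -- `F` and `G` are the two directions of the diffeomorphism on the coverings. By `hF` and `hG`
  -- they depend only on the points of the tori, so any branch of the angles computes the induced
  -- maps.
  let F : EuclideanSpace ℝ (Fin (d + 1)) → M' × Circle := fun x =>
    (P' (tailCoord (φ.symm x)), Circle.exp (φ.symm x 0))
  let G : ℝ × EuclideanSpace ℝ (Fin d) → M := fun v => P (φ (consCoord v))
  have hF {x y} (h : torusExp x = torusExp y) : F x = F y := by
    have h1 := (hφt' x y).2 h
    refine Prod.ext (hPc' ?_) (congrFun h1 0)
    rw [torusExp_tailCoord, torusExp_tailCoord, h1]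
  have hG {t s : ℝ} {x y : EuclideanSpace ℝ (Fin d)} (h : Circle.exp t = Circle.exp s)
      (h' : torusExp x = torusExp y) : G (t, x) = G (s, y) := by
    refine hPc ((hφt _ _).2 ?_)
    rw [torusExp_consCoord, torusExp_consCoord, h, h']
  let f (p : M) : M' × Circle := F (angles 0 (R p))
  let arg (s : ℝ) (w : Circle) : ℝ := s + Complex.arg ((w : ℂ) * ((Circle.exp s)⁻¹ : Circle))
  have harg (s w) : Circle.exp (arg s w) = w := by
    have : Complex.arg ((w : ℂ) * ((Circle.exp s)⁻¹ : Circle)) =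
      Complex.arg ((w * (Circle.exp s)⁻¹ : Circle) : ℂ) := rfl
    simp only [arg, this, Circle.exp_add, Circle.exp_arg]
    rw [mul_comm, inv_mul_cancel_right]
  let g (q : M' × Circle) : M := G (arg 0 q.2, angles 0 (R' q.1))
  have hmem (q : M') (t : ℝ) (a) : φ (consCoord (t, angles a (R' q))) ∈ liftedDomain R :=
    (hφm _).2 (angles_mem_liftedDomain (R := R') a q)
  have hgf (p) : g (f p) = p := by
    have h1 := (hφm' (angles 0 (R p))).2 (angles_mem_liftedDomain 0 p)
    have h2 : g (f p) = P (φ (φ.symm (angles 0 (R p)))) := by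
      refine hPc ((hφt _ _).2 ?_)
      rw [torusExp_consCoord, harg, torusExp_angles]
      simp only [f, F]
      rw [hP' _ h1, ← torusExp_eq_cons]
    rw [h2, φ.apply_symm_apply, hPR]
  have hfg (q) : f (g q) = q := by
    have h1 : f (g q) = F (φ (consCoord (arg 0 q.2, angles 0 (R' q.1)))) := by
      refine hF ?_
      rw [torusExp_angles]
      exact hP _ (hmem _ _ _)
    rw [h1]
    simp only [F, φ.symm_apply_apply]
    refine Prod.ext (hinj' ?_) (harg 0 q.2)
    exact (hP' _ (angles_mem_liftedDomain (R := R') 0 q.1)).trans (torusExp_angles _ _)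
  refine ⟨⟨⟨f, g, hgf, hfg⟩, ?_, ?_⟩⟩
  · refine hR.contMDiff_of_eq (F := F) ?_ fun p x hpx => hF (by rw [torusExp_angles, hpx])
    have h1 : ContMDiffOn 𝓘(ℝ, EuclideanSpace ℝ (Fin (d + 1))) I' ∞
        (fun x => P' (tailCoord (φ.symm x))) (liftedDomain R) :=
      (hR'.2 P' hP').comp (contDiff_tailCoord.comp hφ').contMDiff.contMDiffOn
        fun x hx => (hφm' x).2 hx
    have h2 : ContDiff ℝ ∞ fun x => φ.symm x 0 :=
      (EuclideanSpace.proj (0 : Fin (d + 1)) : EuclideanSpace ℝ (Fin (d + 1)) →L[ℝ]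
        ℝ).contDiff.comp hφ'
    exact h1.prodMk (contMDiff_circleExp.comp h2.contMDiff).contMDiffOn
  · intro q
    obtain ⟨a, ha⟩ := torusExp_surjective (R' q.1)
    have hq : Circle.exp (arg 0 q.2) = q.2 := harg 0 q.2
    set s := arg 0 q.2
    -- The branches at `0` used to define `g` may jump at the given point; branches centred there
    -- are smooth and give the same map.
    have h1 : g = fun q => G (arg s q.2, angles a (R' q.1)) := funext fun q =>
      hG (by rw [harg, harg]) (by rw [torusExp_angles, torusExp_angles])
    have h2 : ContMDiffAt (I'.prod (𝓡 1)) 𝓘(ℝ, ℝ) ∞ (fun q : M' × Circle => arg s q.2) q :=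
      (contMDiffAt_circleArg hq).comp q (contMDiffAt_snd (I := I') (J := 𝓡 1))
    have h3 : ContMDiffAt (I'.prod (𝓡 1)) 𝓘(ℝ, EuclideanSpace ℝ (Fin d)) ∞
        (fun q : M' × Circle => angles a (R' q.1)) q :=
      (hR'.1 q.1 a (by rw [← ha]; exact torusExp_mem_branchDomain_self a)).comp q
        (contMDiffAt_fst (I := I') (J := 𝓡 1))
    have h4 : ContMDiffAt (I'.prod (𝓡 1)) 𝓘(ℝ, EuclideanSpace ℝ (Fin (d + 1))) ∞
        (fun q : M' × Circle => φ (consCoord (arg s q.2, angles a (R' q.1)))) q :=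
      (hφ.comp contDiff_consCoord).contMDiff.contMDiffAt.comp q (h2.prodMk_space h3)
    change ContMDiffAt (I'.prod (𝓡 1)) I ∞ g q
    rw [h1]
    exact contMDiffWithinAt_univ.1 (((hR.2 P hP) _ (hmem _ _ _)).comp q h4.contMDiffWithinAt
      fun q _ => hmem _ _ _)

end TelescopicLinkage

end

theorem mainTheorem9 {d : ℕ} (A : TelescopicLinkage.MetricData (d + 1))
    (hmono : Monotone A.leg)
    (hA : A.Generic) (hA' : A.dropFirst.Generic)
    (hsmall : ∀ ε : Fin (d + 2) → ℝ, TelescopicLinkage.IsSign ε →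
      (0 < ∑ j, ε j * A.dropFirst.lower j → A.leg 0 < ∑ j, ε j * A.dropFirst.lower j) ∧
      (0 < ∑ j, ε j * A.dropFirst.upper j → A.leg 0 < ∑ j, ε j * A.dropFirst.upper j)) :
    ∃ (S : TelescopicLinkage.SmoothStructure A)
      (S' : TelescopicLinkage.SmoothStructure A.dropFirst),
      Nonempty (Diffeomorph
        (TelescopicLinkage.boundaryModel (d + 1))
        ((TelescopicLinkage.boundaryModel d).prod (𝓡 1))
        S.Carrier (S'.Carrier × Circle) ∞) := by
  obtain ⟨S, hS⟩ := hA.exists_smoothStructure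
  obtain ⟨S', hS'⟩ := hA'.exists_smoothStructure
  obtain ⟨φ, hφ, hφ', hφt, hφm⟩ := TelescopicLinkage.MetricData.exists_shape_equiv hA' hsmall
  exact ⟨S, S', TelescopicLinkage.nonempty_diffeomorph_of_torus_equiv hS hS'
    A.shape_injective A.dropFirst.shape_injective φ hφ hφ' hφt fun x => (hφm x).trans
      (A.dropFirst.mem_liftedDomain_shape (TelescopicLinkage.tailCoord x)).symm⟩
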